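/- Let $P$ be a pair of hyperbolic half-pants: one of the two components obtained by cutting a hyperbolic pair of pants, with one cone point $C$ and two closed geodesic boundary components, along its zipper $\zeta$ at $C$ (the shortest geodesic arc from $C$ to $C$ that cannot be homotoped into the boundary). Thus $P$ is a hyperbolic annulus, one of whose boundary components is a closed geodesic $\gamma$, the cuff, while the other one is the geodesic loop $\zeta$ based at $C$. Let $\ell\gamma$ and $\ell\zeta$ be the lengths of the cuff and of the zipper. Then $0<\ell\gamma<\ell\zeta$, and there are precisely two simple complete unit-speed geodesic rays $r_1,r_2$ in $P$ that start at $C$ and spiral onto the cuff $\gamma$. At $C$, the rays $r_1$ and $r_2$ make the same angle with the zipper, each being measured to the nearer of the two ends of $\zeta$ at $C$; the nearer end is one end of $\zeta$ for $r_1$ and the other end for $r_2$. This common angle, the spiral-angle of $P$ at $C$, equals $$\arcsin\left(\frac{\cosh(\ell\gamma/2)}{\cosh(\ell\zeta/2)}\right)-\arcsin\left(\frac{\sinh(\ell\gamma/2)}{\sinh(\ell\zeta/2)}\right).$$ -/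

import Mathlib

open Set Filter Topology UpperHalfPlane
open scoped NNReal

/-- The closed strip `ℝ × [0, 1]`, the universal cover of the closed annulus. -/
abbrev Strip : Type := ℝ × unitInterval

/-- The closed annulus `(ℝ / ℤ) × [0, 1]`. -/
abbrev Annulus : Type := UnitAddCircle × unitInterval

/-- The universal covering map of the annulus; its deck group is generated by
`(s, t) ↦ (s + 1, t)`. -/
def Strip.proj (x : Strip) : Annulus := ((x.1 : UnitAddCircle), x.2)

/-- The hyperbolic angle at `z` between the geodesics from `z` towards `w₁` and `w₂` (both different
from `z`). The map `w ↦ (w - z) / (w - conj z)` is the conformal isometry of the upper half-plane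
onto the Poincaré disc that sends `z` to the centre and so the geodesics issuing from `z` to
straight radii; the hyperbolic angle is the Euclidean angle between these radii. -/
noncomputable def hyperbolicAngle (z w₁ w₂ : ℍ) : ℝ :=
  InnerProductGeometry.angle
    (((w₁ : ℂ) - z) / ((w₁ : ℂ) - (starRingEnd ℂ) (z : ℂ)))
    (((w₂ : ℂ) - z) / ((w₂ : ℂ) - (starRingEnd ℂ) (z : ℂ)))

/-- A pair of hyperbolic half-pants: what is left on one side when a hyperbolic pair of pants with
one cone point `C` and two geodesic boundary components is cut along the zipper at `C`. It is an
annulus with a hyperbolic structure for which one boundary circle (the cuff, `t = 0`) is a closed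
geodesic, and the other one (the zipper, `t = 1`) is a geodesic loop based at the point `C`
(`s = 0`, `t = 1`), at which it may have a corner.

The hyperbolic structure is given by a developing map `dev` on the universal cover, with holonomy
`hol`: the charts of the annulus are the local inverses of the covering followed by `dev`, the
transition maps between them are powers of the isometry `hol`, and all metric notions (lengths,
geodesics, angles) are those of the hyperbolic plane read in these charts. No global injectivity
of `dev`, no convexity, and nothing about the angle at `C` or the type of `hol` is assumed. -/
structure HalfPants where
  /-- The developing map. -/
  dev : Strip → ℍ
  /-- The holonomy of the core curve. -/
  hol : ℍ ≃ᵢ ℍ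
  dev_add_one : ∀ (s : ℝ) (t : unitInterval), dev (s + 1, t) = hol (dev (s, t))
  continuous_dev : Continuous dev
  /-- `dev` is injective near every point, boundary points and the corner included. -/
  locally_injective : ∀ x : Strip, ∃ U ∈ 𝓝 x, InjOn dev U
  /-- In the interior, `dev` is a local homeomorphism. -/
  isLocalHomeomorphOn_interior : IsLocalHomeomorphOn dev {x : Strip | 0 < x.2 ∧ x.2 < 1}
  /-- The cuff is a closed geodesic: its full lift develops into one hyperbolic line. -/
  cuff_geodesic : ∃ e : ℝ → ℍ, Isometry e ∧ ∀ s : ℝ, dev (s, 0) ∈ range e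
  /-- The zipper is a geodesic from `C` to `C`: its lift from one lift of `C` to the next develops
  into one hyperbolic line. -/
  zipper_geodesic : ∃ e : ℝ → ℍ, Isometry e ∧ ∀ s ∈ Icc (0 : ℝ) 1, dev (s, 1) ∈ range e

namespace HalfPants

/-- The cuff, as a subset of the annulus. -/
def cuff : Set Annulus := {x | x.2 = 0}

/-- The (ex-)cone point `C`, the base point of the zipper. -/
def conePoint : Annulus := Strip.proj (0, 1)

/-- The hyperbolic length of the cuff (length of its development over one turn). -/
noncomputable def cuffLength (P : HalfPants) : ℝ :=
  (eVariationOn (fun s : ℝ => P.dev (s, 0)) (Icc 0 1)).toReal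

/-- The hyperbolic length of the zipper (length of its development over one turn). -/
noncomputable def zipperLength (P : HalfPants) : ℝ :=
  (eVariationOn (fun s : ℝ => P.dev (s, 1)) (Icc 0 1)).toReal

/-- `L` is a lift to the universal cover of the path `r : [0, ∞) → P`, and it develops to a
unit-speed geodesic ray of the hyperbolic plane. -/
structure IsGeodesicLift (P : HalfPants) (r : ℝ≥0 → Annulus) (L : ℝ≥0 → Strip) : Prop where
  continuous : Continuous L
  proj_eq : ∀ t, (L t).proj = r t
  isometry : Isometry fun t => P.dev (L t)

/-- `r` is a complete (infinitely long) geodesic ray of `P`, parametrized by arc length. -/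
def IsGeodesicRay (P : HalfPants) (r : ℝ≥0 → Annulus) : Prop :=
  ∃ L, P.IsGeodesicLift r L

/-- `r` is a simple complete geodesic ray of `P` that starts at `C` and spirals onto the cuff:
its limit set is the whole cuff and nothing else. -/
structure IsSpiralRay (P : HalfPants) (r : ℝ≥0 → Annulus) : Prop where
  isGeodesicRay : P.IsGeodesicRay r
  start : r 0 = conePoint
  simple : Function.Injective r
  limitSet : {x : Annulus | MapClusterPt x atTop r} = cuff

/-- The ray `r` starts at `C` and makes there the angle `α` with the initial end of the zipper
`s ↦ (s, 1)`, `0 ≤ s ≤ 1`, and the angle `β` with its terminal end. Near the lift `(0, 1)` of `C`,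
the two ends are the geodesic segments towards the adjacent lifts `(1, 1)` and `(-1, 1)`. -/
def HasZipperAngles (P : HalfPants) (r : ℝ≥0 → Annulus) (α β : ℝ) : Prop :=
  ∃ L, P.IsGeodesicLift r L ∧ L 0 = (0, 1) ∧ ∀ t, 0 < t →
    hyperbolicAngle (P.dev (0, 1)) (P.dev (L t)) (P.dev (1, 1)) = α ∧
    hyperbolicAngle (P.dev (0, 1)) (P.dev (L t)) (P.dev (-1, 1)) = β

end HalfPants

/-!
The developing map is put into a normal form in the upper half-plane: after composition with an
isometry, the cuff develops into the imaginary axis, the holonomy is `z ↦ q z` with `1 < q`, and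
some point develops to the right of the axis (`HalfPants.exists_normalForm`). The holonomy cannot be
a glide reflection, because local injectivity keeps a curve close to the cuff on one side of it
(`eventually_re_ne_zero`). The length of the cuff is then `log q`.

Global injectivity of the developing map is a consequence. In the coordinates `(log |z|², Re z / Im z)`
the zipper is the graph of a positive periodic function. A maximum principle, which holds because the
map is open in the interior, confines the development to the region between the axis and this graph
(`IsGraphRegionMap.mem_graphRegion`). The map to this region is proper, since it is periodic; the set
of points with two preimages is closed, and its part in the open region is open. Points of the axis
have only one preimage, so connectedness of the region makes the map injective, and likewise
surjective (`IsGraphRegionMap.injective`, `IsGraphRegionMap.graphRegion_subset_range`).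

A complete geodesic ray from `C` thus develops into a geodesic ray from `p = dev C` along which
`Re z / Im z`, the hyperbolic sine of the distance from the axis, is bounded. Such a ray is asymptotic
to one of the two ends `∞` and `0` of the axis, which leaves two candidates, exchanged by the inversion
`z ↦ |p|² / conj z` (`eq_verticalRay_or_eq_inversion`). Both stay below the zipper
(`IsNormalForm.verticalRay_mem_graphRegion`, `IsNormalForm.inversion_mem_graphRegion`), hence lift to
the strip. Along them the distance from the axis decreases strictly to `0`, and this distance is a
function on the annulus; so the rays are simple and accumulate exactly on the cuff
(`IsNormalForm.IsSpiralDevelopment.isSpiralRay`).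

The two ends of the zipper at `C` develop into the segments from `p` to `q p` and to `p / q`. The
perpendicular from `p` to the axis bisects the angle between the two segments and also the angle
between the two rays. The half-angles are determined by right-angled hyperbolic trigonometry and are
the two arcsines of the formula (`spiral_trigonometry`); the spiral-angle is their difference.
-/

/-! ### Geodesics of the upper half-plane -/

/-- The point `i eᵗ`; `t ↦ axisPoint t` is the imaginary axis parametrized by arc length. -/
noncomputable def axisPoint (t : ℝ) : ℍ := ⟨⟨0, Real.exp t⟩, Real.exp_pos t⟩

@[simp] lemma axisPoint_re (t : ℝ) : (axisPoint t).re = 0 := rfl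

@[simp] lemma axisPoint_im (t : ℝ) : (axisPoint t).im = Real.exp t := rfl

lemma axisPoint_zero : axisPoint 0 = UpperHalfPlane.I := by
  apply UpperHalfPlane.ext_re_im <;> simp

lemma dist_axisPoint (s t : ℝ) : dist (axisPoint s) (axisPoint t) = |s - t| := by
  rw [UpperHalfPlane.dist_of_re_eq (by simp)]
  simp [Real.dist_eq]

lemma dist_eq_of_cosh_eq {z w z' w' : ℍ}
    (h : Real.cosh (dist z w) = Real.cosh (dist z' w')) : dist z w = dist z' w' := by
  have h1 := Real.cosh_le_cosh.1 h.le
  have h2 := Real.cosh_le_cosh.1 h.ge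
  rw [abs_of_nonneg dist_nonneg, abs_of_nonneg dist_nonneg] at h1 h2
  exact le_antisymm h1 h2

/-- A point is determined by its distances to two points of a geodesic on which it lies. -/
lemma eq_axisPoint_of_dist {v : ℍ} {t d : ℝ} (hd : d ≠ 0) (h0 : dist v (axisPoint 0) = |t|)
    (h1 : dist v (axisPoint d) = |t - d|) : v = axisPoint t := by
  have hy := v.im_pos
  have e0 := UpperHalfPlane.cosh_dist' v (axisPoint 0)
  have e1 := UpperHalfPlane.cosh_dist' v (axisPoint d)
  rw [h0, Real.cosh_abs, Real.cosh_eq, Real.exp_neg] at e0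
  rw [h1, Real.cosh_abs, Real.cosh_eq, neg_sub, Real.exp_sub, Real.exp_sub] at e1
  simp only [axisPoint_re, axisPoint_im, sub_zero, Real.exp_zero] at e0 e1
  have hD := Real.exp_pos d
  have hT := Real.exp_pos t
  have hD1 : Real.exp d ≠ 1 := by simpa using hd
  generalize Real.exp d = D at *
  have hre : v.re ^ 2 = 0 ∧ v.im = Real.exp t := by
    generalize Real.exp t = T at *
    generalize v.im = y at *
    generalize v.re = x at *
    field_simp at e0 e1
    have hy : y = T := by
      have : (D ^ 2 - 1) * (y - T) = 0 := by linear_combination e1 - e0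
      rcases mul_eq_zero.1 this with h | h
      · exact absurd (by nlinarith : D = 1) hD1
      · linarith
    subst hy
    refine ⟨?_, rfl⟩
    have : y * x ^ 2 = 0 := by linear_combination -e0
    exact (mul_eq_zero.1 this).resolve_left hT.ne'
  exact UpperHalfPlane.ext_re_im (by simpa using hre.1) (by simpa using hre.2)

lemma specialLinear_smul_re (g : Matrix.SpecialLinearGroup (Fin 2) ℝ) (z : ℍ) :
    (g • z).re = ((g 0 0 * z.re + g 0 1) * (g 1 0 * z.re + g 1 1) + g 0 0 * g 1 0 * z.im ^ 2) /
      ((g 1 0 * z.re + g 1 1) ^ 2 + (g 1 0 * z.im) ^ 2) := by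
  rw [← UpperHalfPlane.coe_re, UpperHalfPlane.coe_specialLinearGroup_apply]
  simp [Complex.div_re, Complex.normSq_apply]
  ring

lemma specialLinear_smul_im (g : Matrix.SpecialLinearGroup (Fin 2) ℝ) (z : ℍ) :
    (g • z).im = z.im / ((g 1 0 * z.re + g 1 1) ^ 2 + (g 1 0 * z.im) ^ 2) := by
  have hg := g.det_coe
  rw [Matrix.det_fin_two] at hg
  rw [← UpperHalfPlane.coe_im, UpperHalfPlane.coe_specialLinearGroup_apply]
  simp only [Complex.div_im, Complex.normSq_apply]
  simp
  rw [← sub_div]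
  congr 1
  · linear_combination z.im * hg
  · ring

lemma exists_specialLinear {a b c d : ℝ} (h : a * d - b * c = 1) :
    ∃ g : Matrix.SpecialLinearGroup (Fin 2) ℝ, g 0 0 = a ∧ g 0 1 = b ∧ g 1 0 = c ∧ g 1 1 = d :=
  ⟨⟨!![a, b; c, d], by rw [Matrix.det_fin_two]; simpa using h⟩, rfl, rfl, rfl, rfl⟩

/-- A rotation about `i` puts any given point on the imaginary axis. -/
lemma exists_rotation (w : ℍ) : ∃ g : Matrix.SpecialLinearGroup (Fin 2) ℝ,
    g • UpperHalfPlane.I = UpperHalfPlane.I ∧ (g • w).re = 0 := by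
  -- The real part of the rotated point has the sign of `h θ`, and `h (π / 2) = -h 0`.
  set h : ℝ → ℝ := fun θ => Real.cos (2 * θ) * w.re +
    Real.sin (2 * θ) * ((1 - w.re ^ 2 - w.im ^ 2) / 2) with hh
  have hc : Continuous h := by fun_prop
  have h0 : h 0 = w.re := by simp [hh]
  have h1 : h (Real.pi / 2) = - w.re := by
    simp [hh, show 2 * (Real.pi / 2) = Real.pi by ring]
  obtain ⟨θ, -, hθ⟩ : (0 : ℝ) ∈ h '' (uIcc 0 (Real.pi / 2)) := by
    apply intermediate_value_uIcc hc.continuousOn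
    rw [h0, h1, mem_uIcc]
    rcases le_total 0 w.re with h | h
    · right; constructor <;> linarith
    · left; constructor <;> linarith
  obtain ⟨g, g00, g01, g10, g11⟩ := exists_specialLinear (a := Real.cos θ) (b := Real.sin θ)
    (c := -Real.sin θ) (d := Real.cos θ) (by nlinarith [Real.sin_sq_add_cos_sq θ])
  refine ⟨g, ?_, ?_⟩
  · apply UpperHalfPlane.ext_re_im
    · rw [specialLinear_smul_re, g00, g01, g10, g11]; simp; ring
    · rw [specialLinear_smul_im, g10, g11]; simp [Real.cos_sq_add_sin_sq]
  · rw [specialLinear_smul_re, g00, g01, g10, g11]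
    simp only [hh, Real.cos_two_mul', Real.sin_two_mul] at hθ
    rw [div_eq_zero_iff]
    left
    linear_combination hθ

lemma exists_smul_axisPoint (z w : ℍ) : ∃ g : Matrix.SpecialLinearGroup (Fin 2) ℝ,
    g • z = axisPoint 0 ∧ g • w = axisPoint (dist z w) := by
  obtain ⟨g₁, hg₁⟩ := MulAction.exists_smul_eq (Matrix.SpecialLinearGroup (Fin 2) ℝ) z
    UpperHalfPlane.I
  obtain ⟨g₂, hg₂, hre⟩ := exists_rotation (g₁ • w)
  set v := g₂ • g₁ • w with hv
  have hvax : v = axisPoint (Real.log v.im) := by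
    apply UpperHalfPlane.ext_re_im
    · simpa using hre
    · simp [Real.exp_log v.im_pos]
  have hz : g₂ • g₁ • z = axisPoint 0 := by rw [hg₁, hg₂, axisPoint_zero]
  have hd : dist z w = |Real.log v.im| := by
    rw [← dist_smul g₁ z w, ← dist_smul g₂ (g₁ • z) (g₁ • w), hz, ← hv, hvax, dist_axisPoint]
    simp
  rcases le_total 0 (Real.log v.im) with h | h
  · refine ⟨g₂ * g₁, by rw [mul_smul, hz], ?_⟩
    rw [mul_smul, ← hv, hd, abs_of_nonneg h, ← hvax]
  -- If the rotated point lies below `i`, the half-turn `z ↦ -1 / z` moves it above.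
  · obtain ⟨S, S00, S01, S10, S11⟩ := exists_specialLinear (a := 0) (b := -1) (c := 1) (d := 0)
      (by norm_num)
    have hS : ∀ t, S • axisPoint t = axisPoint (-t) := by
      intro t
      apply UpperHalfPlane.ext_re_im
      · rw [specialLinear_smul_re, S00, S01, S10, S11]; simp
      · rw [specialLinear_smul_im, S10, S11]
        simp [Real.exp_neg]
        have := (Real.exp_pos t).ne'
        field_simp
    refine ⟨S * (g₂ * g₁), by rw [mul_smul, mul_smul, hz, hS, neg_zero], ?_⟩
    rw [mul_smul, mul_smul, ← hv, hvax, hS, hd, abs_of_nonpos h]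

/-- Every unit-speed geodesic, here parametrized through `f`, is a translate of the imaginary
axis by an orientation-preserving isometry. -/
lemma exists_smul_eq_axisPoint {α : Type*} {e : α → ℍ} {f : α → ℝ}
    (h : ∀ x y, dist (e x) (e y) = |f x - f y|) {x₀ x₁ : α} (h₀ : f x₀ = 0) (h₁ : f x₁ = 1) :
    ∃ g : Matrix.SpecialLinearGroup (Fin 2) ℝ, ∀ x, g • e x = axisPoint (f x) := by
  obtain ⟨g, hz, hw⟩ := exists_smul_axisPoint (e x₀) (e x₁)
  rw [h, h₀, h₁, show |(0 : ℝ) - 1| = 1 by norm_num] at hw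
  refine ⟨g, fun x => eq_axisPoint_of_dist one_ne_zero ?_ ?_⟩
  · rw [← hz, dist_smul, h, h₀, sub_zero]
  · rw [← hw, dist_smul, h, h₁]

lemma Isometry.exists_smul_eq_axisPoint {e : ℝ → ℍ} (he : Isometry e) :
    ∃ g : Matrix.SpecialLinearGroup (Fin 2) ℝ, ∀ t, g • e t = axisPoint t :=
  _root_.exists_smul_eq_axisPoint (f := id)
    (fun x y => by rw [he.dist_eq, Real.dist_eq]; rfl) (x₀ := 0) (x₁ := 1) rfl rfl

lemma Isometry.exists_smul_eq_axisPoint_nnreal {e : ℝ≥0 → ℍ} (he : Isometry e) :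
    ∃ g : Matrix.SpecialLinearGroup (Fin 2) ℝ, ∀ t, g • e t = axisPoint t :=
  _root_.exists_smul_eq_axisPoint (f := fun t : ℝ≥0 => (t : ℝ))
    (fun x y => by rw [he.dist_eq, NNReal.dist_eq]) (x₀ := 0) (x₁ := 1) rfl rfl

/-! ### Isometries and angles -/

/-- The reflection of the upper half-plane in the imaginary axis. -/
noncomputable def axisReflection : ℍ ≃ᵢ ℍ :=
  IsometryEquiv.mk' (fun z => ⟨⟨-z.re, z.im⟩, z.im_pos⟩) (fun z => ⟨⟨-z.re, z.im⟩, z.im_pos⟩)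
    (fun z => by apply UpperHalfPlane.ext_re_im <;> simp)
    (Isometry.of_dist_eq fun z w => dist_eq_of_cosh_eq (by
      rw [UpperHalfPlane.cosh_dist', UpperHalfPlane.cosh_dist']
      simp only [UpperHalfPlane.mk_re, UpperHalfPlane.mk_im]
      congr 3; ring))

@[simp] lemma axisReflection_re (z : ℍ) : (axisReflection z).re = -z.re := rfl

@[simp] lemma axisReflection_im (z : ℍ) : (axisReflection z).im = z.im := rfl

/-- The squared Euclidean modulus of a point of the upper half-plane. -/
noncomputable def modSq (z : ℍ) : ℝ := z.re ^ 2 + z.im ^ 2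

lemma modSq_pos (z : ℍ) : 0 < modSq z := by
  have := z.im_pos
  unfold modSq; positivity

lemma continuous_modSq : Continuous modSq :=
  (UpperHalfPlane.continuous_re.pow 2).add (UpperHalfPlane.continuous_im.pow 2)

/-- The reflection `z ↦ |p|² / conj z` in the geodesic through `p` orthogonal to the
imaginary axis. -/
noncomputable def inversion (p z : ℍ) : ℍ :=
  ⟨⟨modSq p * z.re / modSq z, modSq p * z.im / modSq z⟩,
    div_pos (mul_pos (modSq_pos p) z.im_pos) (modSq_pos z)⟩

@[simp] lemma inversion_re (p z : ℍ) : (inversion p z).re = modSq p * z.re / modSq z := rfl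

@[simp] lemma inversion_im (p z : ℍ) : (inversion p z).im = modSq p * z.im / modSq z := rfl

lemma isometry_inversion (p : ℍ) : Isometry (inversion p) :=
  Isometry.of_dist_eq fun z w => dist_eq_of_cosh_eq (by
    rw [UpperHalfPlane.cosh_dist', UpperHalfPlane.cosh_dist']
    have hz := z.im_ne_zero
    have hw := w.im_ne_zero
    have hp := (modSq_pos p).ne'
    have hz' := (modSq_pos z).ne'
    have hw' := (modSq_pos w).ne'
    simp only [inversion_re, inversion_im]
    field_simp
    simp only [modSq]
    ring)

lemma inversion_self (p : ℍ) : inversion p p = p := by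
  have hp := (modSq_pos p).ne'
  apply UpperHalfPlane.ext_re_im
  · simp; field_simp
  · simp; field_simp

lemma modSq_inversion (p z : ℍ) : modSq (inversion p z) = modSq p ^ 2 / modSq z := by
  have hz := (modSq_pos z).ne'
  change (modSq p * z.re / modSq z) ^ 2 + (modSq p * z.im / modSq z) ^ 2 = _
  field_simp
  rfl

lemma inversion_inversion (p z : ℍ) : inversion p (inversion p z) = z := by
  have hp := (modSq_pos p).ne'
  have hz := (modSq_pos z).ne'
  apply UpperHalfPlane.ext_re_im
  · rw [inversion_re, modSq_inversion, inversion_re]; field_simp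
  · rw [inversion_im, modSq_inversion, inversion_im]; field_simp

/-- The hyperbolic law of cosines. -/
lemma hyperbolicAngle_eq_arccos {z w₁ w₂ : ℍ} (h₁ : w₁ ≠ z) (h₂ : w₂ ≠ z) :
    hyperbolicAngle z w₁ w₂ =
      Real.arccos ((Real.cosh (dist w₁ z) * Real.cosh (dist w₂ z) - Real.cosh (dist w₁ w₂)) /
        (Real.sinh (dist w₁ z) * Real.sinh (dist w₂ z))) := by
  have hy := z.im_pos
  have hs : ∀ w : ℍ, Real.sinh (dist w z) =
      dist (w : ℂ) z * dist (w : ℂ) ((starRingEnd ℂ) (z : ℂ)) / (2 * w.im * z.im) := by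
    intro w
    have hw := w.im_pos
    have : dist w z = 2 * (dist w z / 2) := by ring
    rw [this, Real.sinh_two_mul, UpperHalfPlane.sinh_half_dist, UpperHalfPlane.cosh_half_dist]
    have h2 : √(w.im * z.im) ^ 2 = w.im * z.im := Real.sq_sqrt (by positivity)
    have h3 : 0 < √(w.im * z.im) := Real.sqrt_pos.2 (by positivity)
    have h4 : 2 * w.im * z.im = 2 * √(w.im * z.im) ^ 2 := by rw [h2]; ring
    rw [h4]
    field_simp
  unfold hyperbolicAngle InnerProductGeometry.angle
  congr 1
  rw [hs, hs, UpperHalfPlane.cosh_dist', UpperHalfPlane.cosh_dist', UpperHalfPlane.cosh_dist']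
  have hA : ∀ {w : ℍ}, w ≠ z → 0 < ‖(w : ℂ) - z‖ := fun h =>
    norm_pos_iff.2 (sub_ne_zero.2 (by simpa using h))
  have hB : ∀ w : ℍ, 0 < ‖(w : ℂ) - (starRingEnd ℂ) (z : ℂ)‖ := fun w => by
    rw [norm_pos_iff, sub_ne_zero]
    intro h
    have := congrArg Complex.im h
    simp at this
    linarith [w.im_pos]
  have hw1 := w₁.im_pos
  have hw2 := w₂.im_pos
  have hin : ∀ a b : ℂ, inner ℝ a b = a.re * b.re + a.im * b.im := fun a b => by
    rw [Complex.inner]; simp; ring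
  rw [norm_div, norm_div, dist_eq_norm, dist_eq_norm, dist_eq_norm, dist_eq_norm, hin]
  simp only [Complex.div_re, Complex.div_im, Complex.normSq_eq_norm_sq]
  have a1 := hA h₁
  have a2 := hA h₂
  have b1 := hB w₁
  have b2 := hB w₂
  generalize ‖(w₁ : ℂ) - (starRingEnd ℂ) (z : ℂ)‖ = B1 at *
  generalize ‖(w₂ : ℂ) - (starRingEnd ℂ) (z : ℂ)‖ = B2 at *
  generalize ‖(w₁ : ℂ) - z‖ = A1 at *
  generalize ‖(w₂ : ℂ) - z‖ = A2 at *
  simp only [Complex.sub_re, Complex.sub_im, Complex.conj_re, Complex.conj_im,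
    UpperHalfPlane.coe_re, UpperHalfPlane.coe_im, sub_neg_eq_add]
  field_simp
  ring

lemma hyperbolicAngle_map {φ : ℍ → ℍ} (hφ : Isometry φ) {z w₁ w₂ : ℍ} (h₁ : w₁ ≠ z)
    (h₂ : w₂ ≠ z) : hyperbolicAngle (φ z) (φ w₁) (φ w₂) = hyperbolicAngle z w₁ w₂ := by
  rw [hyperbolicAngle_eq_arccos h₁ h₂,
    hyperbolicAngle_eq_arccos (hφ.injective.ne h₁) (hφ.injective.ne h₂)]
  simp only [hφ.dist_eq]

/-! ### Equivariant maps of the strip onto a region below a graph -/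

lemma exists_forall_le_of_periodic {G : Strip → ℝ} (hG : Continuous G)
    (hper : ∀ s t, G (s + 1, t) = G (s, t)) : ∃ x, ∀ y, G y ≤ G x := by
  have hK : IsCompact (Icc (0 : ℝ) 1 ×ˢ (univ : Set unitInterval)) :=
    isCompact_Icc.prod isCompact_univ
  obtain ⟨x, -, hx⟩ := hK.exists_isMaxOn ⟨(0, 0), by simp⟩ hG.continuousOn
  refine ⟨x, fun y => ?_⟩
  obtain ⟨s, hs, e⟩ := Function.Periodic.exists_mem_Ico₀ (f := fun s => G (s, y.2)) (c := 1)
    (fun s => hper s y.2) one_pos y.1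
  have := isMaxOn_iff.1 hx (s, y.2) ⟨⟨hs.1, hs.2.le⟩, mem_univ _⟩
  rwa [← e] at this

/-- Neighbourhoods in the plane contain points straight above and straight below. -/
lemma exists_vertical_of_eventually {a : ℝ × ℝ} {p : ℝ × ℝ → Prop} (h : ∀ᶠ y in 𝓝 a, p y) :
    ∃ ε > 0, p (a.1, a.2 + ε) ∧ p (a.1, a.2 - ε) := by
  have h1 : Tendsto (fun ε : ℝ => (a.1, a.2 + ε)) (𝓝[>] 0) (𝓝 a) := by
    have : Continuous (fun ε : ℝ => (a.1, a.2 + ε)) := by fun_prop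
    simpa using (this.tendsto 0).mono_left nhdsWithin_le_nhds
  have h2 : Tendsto (fun ε : ℝ => (a.1, a.2 - ε)) (𝓝[>] 0) (𝓝 a) := by
    have : Continuous (fun ε : ℝ => (a.1, a.2 - ε)) := by fun_prop
    simpa using (this.tendsto 0).mono_left nhdsWithin_le_nhds
  obtain ⟨ε, h3, h4, h5⟩ := ((h1.eventually h).and ((h2.eventually h).and
    (self_mem_nhdsWithin : Ioi (0 : ℝ) ∈ 𝓝[>] 0))).exists
  exact ⟨ε, h5, h3, h4⟩

/-- A map of the strip to the plane that looks locally like the parametrization of the region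
`{(τ, η) | 0 ≤ η ≤ K τ}` and commutes with the translations by `1` and by `ℓ`. The bottom of the
strip goes to the axis `η = 0` and its top to the graph of `K`. -/
structure IsGraphRegionMap (Ψ : Strip → ℝ × ℝ) (ℓ : ℝ) (K : ℝ → ℝ) : Prop where
  continuous : Continuous Ψ
  locally_injective : ∀ x, ∃ U ∈ 𝓝 x, InjOn Ψ U
  map_nhds_eq : ∀ x : Strip, 0 < x.2 → x.2 < 1 → map Ψ (𝓝 x) = 𝓝 (Ψ x)
  add_one : ∀ s t, Ψ (s + 1, t) = Ψ (s, t) + (ℓ, 0)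
  translation_pos : 0 < ℓ
  continuous_graph : Continuous K
  graph_pos : ∀ τ, 0 < K τ
  graph_add : ∀ τ, K (τ + ℓ) = K τ
  bottom : ∀ s, (Ψ (s, 0)).2 = 0
  top : ∀ s, (Ψ (s, 1)).2 = K (Ψ (s, 1)).1
  bottom_injective : Function.Injective fun s => (Ψ (s, 0)).1
  top_injective : Function.Injective fun s => (Ψ (s, 1)).1

/-- The open region between the axis and the graph of `K`. -/
def graphRegion (K : ℝ → ℝ) : Set (ℝ × ℝ) := {y | 0 < y.2 ∧ y.2 < K y.1}

lemma isPreconnected_graphRegion {K : ℝ → ℝ} (hK : Continuous K) (hpos : ∀ τ, 0 < K τ) :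
    IsPreconnected (graphRegion K) := by
  have : graphRegion K =
      (fun y : ℝ × ℝ => (y.1, y.2 * K y.1)) '' ((univ : Set ℝ) ×ˢ Ioo (0 : ℝ) 1) := by
    ext ⟨a, b⟩
    constructor
    · rintro ⟨h1, h2⟩
      have := hpos a
      exact ⟨(a, b / K a), ⟨mem_univ _, div_pos h1 this, (div_lt_one this).2 h2⟩,
        Prod.ext rfl (div_mul_cancel₀ _ this.ne')⟩
    · rintro ⟨⟨c, d⟩, ⟨-, h1, h2⟩, h⟩
      simp only [Prod.mk.injEq] at h
      obtain ⟨rfl, rfl⟩ := h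
      have := hpos c
      exact ⟨mul_pos h1 this, by simpa using mul_lt_mul_of_pos_right h2 this⟩
  rw [this]
  exact (isPreconnected_univ.prod isPreconnected_Ioo).image _ (by fun_prop)

lemma unitInterval_cases (t : unitInterval) : t = 0 ∨ t = 1 ∨ 0 < t ∧ t < 1 := by
  rcases eq_or_ne t 0 with h | h
  · exact Or.inl h
  rcases eq_or_ne t 1 with h' | h'
  · exact Or.inr (Or.inl h')
  exact Or.inr (Or.inr ⟨unitInterval.pos_iff_ne_zero.2 h, unitInterval.lt_one_iff_ne_one.2 h'⟩)

namespace IsGraphRegionMap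

variable {Ψ : Strip → ℝ × ℝ} {ℓ : ℝ} {K : ℝ → ℝ}

/-- The maximum principle: the map is open in the interior, so that neither the distance from
the graph of `K` nor the height `η` has an interior extremum. -/
lemma mem_graphRegion (h : IsGraphRegionMap Ψ ℓ K) {x : Strip} (h0 : 0 < x.2) (h1 : x.2 < 1) :
    Ψ x ∈ graphRegion K := by
  have hΨ := h.continuous
  have hK := h.continuous_graph
  constructor
  · have key : ∀ x : Strip, 0 < x.2 → x.2 < 1 → ¬ ∀ y, (Ψ x).2 ≤ (Ψ y).2 := by
      intro x h0 h1 hmin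
      have : ∀ᶠ y in 𝓝 (Ψ x), (Ψ x).2 ≤ y.2 := by
        rw [← h.map_nhds_eq x h0 h1, eventually_map]
        exact Eventually.of_forall hmin
      obtain ⟨ε, hε, -, h2⟩ := exists_vertical_of_eventually this
      simp only at h2
      linarith
    obtain ⟨x₀, hx₀⟩ := exists_forall_le_of_periodic (G := fun x => -(Ψ x).2) (by fun_prop)
      (fun s t => by simp [h.add_one])
    have hnn : 0 ≤ (Ψ x₀).2 := by
      rcases unitInterval_cases x₀.2 with h2 | h2 | ⟨h2, h3⟩
      · rw [show x₀ = (x₀.1, 0) from Prod.ext rfl h2, h.bottom]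
      · rw [show x₀ = (x₀.1, 1) from Prod.ext rfl h2, h.top]
        exact (h.graph_pos _).le
      · exact absurd (fun y => neg_le_neg_iff.1 (hx₀ y)) (key x₀ h2 h3)
    have hall : ∀ y, 0 ≤ (Ψ y).2 := fun y => hnn.trans (neg_le_neg_iff.1 (hx₀ y))
    refine lt_of_le_of_ne (hall x) fun he => key x h0 h1 fun y => he ▸ hall y
  · have key : ∀ x : Strip, 0 < x.2 → x.2 < 1 →
        ¬ ∀ y, (Ψ y).2 - K (Ψ y).1 ≤ (Ψ x).2 - K (Ψ x).1 := by
      intro x h0 h1 hmax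
      have : ∀ᶠ y in 𝓝 (Ψ x), y.2 - K y.1 ≤ (Ψ x).2 - K (Ψ x).1 := by
        rw [← h.map_nhds_eq x h0 h1, eventually_map]
        exact Eventually.of_forall hmax
      obtain ⟨ε, hε, h2, -⟩ := exists_vertical_of_eventually this
      simp only at h2
      linarith
    obtain ⟨x₀, hx₀⟩ := exists_forall_le_of_periodic (G := fun x => (Ψ x).2 - K (Ψ x).1)
      (by fun_prop) (fun s t => by simp [h.add_one, h.graph_add])
    have hnn : (Ψ x₀).2 - K (Ψ x₀).1 ≤ 0 := by
      rcases unitInterval_cases x₀.2 with h2 | h2 | ⟨h2, h3⟩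
      · rw [show x₀ = (x₀.1, 0) from Prod.ext rfl h2, h.bottom]
        linarith [h.graph_pos (Ψ (x₀.1, 0)).1]
      · rw [show x₀ = (x₀.1, 1) from Prod.ext rfl h2, h.top]
        simp
      · exact absurd hx₀ (key x₀ h2 h3)
    have hall : ∀ y, (Ψ y).2 - K (Ψ y).1 ≤ 0 := fun y => (hx₀ y).trans hnn
    rw [← sub_neg]
    refine lt_of_le_of_ne (hall x) fun he => key x h0 h1 fun y => he ▸ hall y

lemma mem_graphRegion_iff (h : IsGraphRegionMap Ψ ℓ K) {x : Strip} :
    Ψ x ∈ graphRegion K ↔ 0 < x.2 ∧ x.2 < 1 := by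
  refine ⟨fun hx => ?_, fun hx => h.mem_graphRegion hx.1 hx.2⟩
  rcases unitInterval_cases x.2 with h2 | h2 | h2
  · rw [show x = (x.1, 0) from Prod.ext rfl h2] at hx
    exact absurd (h.bottom _) hx.1.ne'
  · rw [show x = (x.1, 1) from Prod.ext rfl h2] at hx
    exact absurd (h.top _) hx.2.ne
  · exact h2

lemma height_eq_zero_iff (h : IsGraphRegionMap Ψ ℓ K) {x : Strip} : (Ψ x).2 = 0 ↔ x.2 = 0 := by
  constructor
  · intro hx
    rcases unitInterval_cases x.2 with h2 | h2 | h2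
    · exact h2
    · rw [show x = (x.1, 1) from Prod.ext rfl h2, h.top] at hx
      exact absurd hx (h.graph_pos _).ne'
    · exact absurd hx (h.mem_graphRegion h2.1 h2.2).1.ne'
  · intro hx
    rw [show x = (x.1, 0) from Prod.ext rfl hx, h.bottom]

lemma isProperMap (h : IsGraphRegionMap Ψ ℓ K) : IsProperMap Ψ := by
  have hΨ := h.continuous
  have hℓ := h.translation_pos
  rw [isProperMap_iff_isCompact_preimage]
  refine ⟨hΨ, fun C hC => ?_⟩
  have hper : ∀ s t, (Ψ (s + 1, t)).1 - ℓ * (s + 1) = (Ψ (s, t)).1 - ℓ * s := fun s t => by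
    rw [h.add_one]; simp; ring
  obtain ⟨x₁, hx₁⟩ := exists_forall_le_of_periodic (G := fun x => (Ψ x).1 - ℓ * x.1)
    (by fun_prop) hper
  obtain ⟨x₂, hx₂⟩ := exists_forall_le_of_periodic (G := fun x => -((Ψ x).1 - ℓ * x.1))
    (by fun_prop) (fun s t => by simp only [hper])
  obtain ⟨A, hA⟩ := (hC.image continuous_fst).bddAbove
  obtain ⟨B, hB⟩ := (hC.image continuous_fst).bddBelow
  refine IsCompact.of_isClosed_subset
    ((isCompact_Icc (a := (B - ((Ψ x₁).1 - ℓ * x₁.1)) / ℓ)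
      (b := (A - ((Ψ x₂).1 - ℓ * x₂.1)) / ℓ)).prod
      (isCompact_univ (X := unitInterval))) (hC.isClosed.preimage hΨ) ?_
  intro x hx
  have h1 := hA ⟨_, hx, rfl⟩
  have h2 := hB ⟨_, hx, rfl⟩
  have h3 := hx₁ x
  have h4 := hx₂ x
  refine ⟨⟨?_, ?_⟩, mem_univ _⟩
  · rw [div_le_iff₀ hℓ]; linarith
  · rw [le_div_iff₀ hℓ]; linarith

/-- The set of points with at least two preimages is closed and its part in the open region is
open; as the region is connected and the points of the axis have one preimage only, no point of
the region has two. -/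
lemma injective (h : IsGraphRegionMap Ψ ℓ K) : Function.Injective Ψ := by
  set W : Set (Strip × Strip) := {w | Ψ w.1 = Ψ w.2 ∧ w.1 ≠ w.2} with hW
  have hWc : IsClosed W := by
    rw [← isOpen_compl_iff, isOpen_iff_mem_nhds]
    rintro ⟨x, x'⟩ hx
    by_cases hxx : x = x'
    · subst hxx
      obtain ⟨U, hU, hinj⟩ := h.locally_injective x
      filter_upwards [prod_mem_nhds hU hU] with w hw hw'
      exact hw'.2 (hinj hw.1 hw.2 hw'.1)
    · have hne : Ψ x ≠ Ψ x' := fun he => hx ⟨he, hxx⟩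
      have ho : IsOpen {w : Strip × Strip | Ψ w.1 ≠ Ψ w.2} :=
        isOpen_ne_fun (h.continuous.comp continuous_fst) (h.continuous.comp continuous_snd)
      filter_upwards [ho.mem_nhds hne] with w hw hw'
      exact hw hw'.1
  set N : Set (ℝ × ℝ) := {y | (y, y) ∈ Prod.map Ψ Ψ '' W} with hN
  have hNc : IsClosed N :=
    ((h.isProperMap.prodMap h.isProperMap).isClosedMap _ hWc).preimage (by fun_prop)
  have hmem : ∀ {x x'}, Ψ x = Ψ x' → x ≠ x' → Ψ x ∈ N := fun {x x'} he hne =>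
    ⟨(x, x'), ⟨he, hne⟩, by simp [he]⟩
  have hNR : ∀ y ∈ N, y ∈ graphRegion K → N ∈ 𝓝 y := by
    rintro y ⟨⟨x, x'⟩, ⟨he, hne⟩, hy⟩ hyR
    simp only [Prod.map_apply, Prod.mk.injEq] at hy
    obtain ⟨rfl, hy⟩ := hy
    have hx := h.mem_graphRegion_iff.1 hyR
    have hx' := h.mem_graphRegion_iff.1 (hy ▸ hyR)
    obtain ⟨U, V, hU, hV, hxU, hxV, hd⟩ := t2_separation hne
    have m1 : Ψ '' U ∈ 𝓝 (Ψ x) := by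
      rw [← h.map_nhds_eq x hx.1 hx.2]; exact image_mem_map (hU.mem_nhds hxU)
    have m2 : Ψ '' V ∈ 𝓝 (Ψ x) := by
      rw [← hy, ← h.map_nhds_eq x' hx'.1 hx'.2]; exact image_mem_map (hV.mem_nhds hxV)
    filter_upwards [m1, m2]
    rintro _ ⟨u, hu, rfl⟩ ⟨v, hv, huv⟩
    exact hmem huv.symm (fun e => disjoint_left.1 hd hu (e ▸ hv))
  have hbot : ∀ {x x'}, Ψ x = Ψ x' → x.2 = 0 → x = x' := by
    intro x x' he h0
    have h0' : x'.2 = 0 := h.height_eq_zero_iff.1 (he ▸ h.height_eq_zero_iff.2 h0)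
    refine Prod.ext (h.bottom_injective ?_) (h0.trans h0'.symm)
    change (Ψ (x.1, 0)).1 = (Ψ (x'.1, 0)).1
    rw [← show x = (x.1, 0) from Prod.ext rfl h0, ← show x' = (x'.1, 0) from Prod.ext rfl h0', he]
  have hempty : ∀ y ∈ graphRegion K, y ∉ N := by
    intro y hyR hyN
    have hsub : graphRegion K ⊆ interior N := by
      refine (isPreconnected_graphRegion h.continuous_graph h.graph_pos).subset_left_of_subset_union
        isOpen_interior hNc.isOpen_compl ?_ ?_ ⟨y, hyR, mem_interior_iff_mem_nhds.2 (hNR y hyN hyR)⟩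
      · exact disjoint_left.2 fun z hz hz' => hz' (interior_subset hz)
      · intro z hz
        by_cases hzN : z ∈ N
        · exact Or.inl (mem_interior_iff_mem_nhds.2 (hNR z hzN hz))
        · exact Or.inr hzN
    have h0 : ((0 : ℝ), (0 : ℝ)) ∈ N := by
      have hcl : ((0 : ℝ), (0 : ℝ)) ∈ closure (graphRegion K) := by
        have ht : Tendsto (fun ε : ℝ => ((0 : ℝ), ε)) (𝓝[>] 0) (𝓝 (0, 0)) := by
          have : Continuous (fun ε : ℝ => ((0 : ℝ), ε)) := by fun_prop
          exact (this.tendsto 0).mono_left nhdsWithin_le_nhds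
        refine mem_closure_of_tendsto ht ?_
        filter_upwards [Ioo_mem_nhdsGT (h.graph_pos 0)] with ε hε using hε
      exact closure_minimal (hsub.trans interior_subset) hNc hcl
    obtain ⟨⟨x, x'⟩, ⟨he, hne⟩, hy⟩ := h0
    simp only [Prod.map_apply, Prod.mk.injEq] at hy
    exact hne (hbot he (h.height_eq_zero_iff.1 (by rw [hy.1])))
  intro x x' he
  by_contra hne
  rcases unitInterval_cases x.2 with h2 | h2 | h2
  · exact hne (hbot he h2)
  · rcases unitInterval_cases x'.2 with h3 | h3 | h3
    · exact hne (hbot he.symm h3).symm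
    · refine hne (Prod.ext (h.top_injective ?_) (h2.trans h3.symm))
      change (Ψ (x.1, 1)).1 = (Ψ (x'.1, 1)).1
      rw [← show x = (x.1, 1) from Prod.ext rfl h2, ← show x' = (x'.1, 1) from Prod.ext rfl h3, he]
    · exact hempty _ (h.mem_graphRegion_iff.2 h3) (hmem he.symm (Ne.symm hne))
  · exact hempty _ (h.mem_graphRegion_iff.2 h2) (hmem he hne)

lemma isClosedEmbedding (h : IsGraphRegionMap Ψ ℓ K) : IsClosedEmbedding Ψ :=
  .of_continuous_injective_isClosedMap h.continuous h.injective h.isProperMap.isClosedMap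

lemma graphRegion_subset_range (h : IsGraphRegionMap Ψ ℓ K) : graphRegion K ⊆ range Ψ := by
  have hc : IsClosed (range Ψ) := h.isClosedEmbedding.isClosed_range
  have hopen : ∀ y ∈ range Ψ, y ∈ graphRegion K → range Ψ ∈ 𝓝 y := by
    rintro _ ⟨x, rfl⟩ hx
    have hx' := h.mem_graphRegion_iff.1 hx
    rw [← h.map_nhds_eq x hx'.1 hx'.2]
    exact range_mem_map
  let m : Strip := (0, ⟨1 / 2, by norm_num, by norm_num⟩)
  have hm : Ψ m ∈ graphRegion K :=
    h.mem_graphRegion (Subtype.coe_lt_coe.1 (by norm_num [m])) (Subtype.coe_lt_coe.1 (by norm_num [m]))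
  refine Subset.trans (?_ : graphRegion K ⊆ interior (range Ψ)) interior_subset
  refine (isPreconnected_graphRegion h.continuous_graph h.graph_pos).subset_left_of_subset_union
    isOpen_interior hc.isOpen_compl ?_ ?_
    ⟨Ψ m, hm, mem_interior_iff_mem_nhds.2 (hopen _ (mem_range_self _) hm)⟩
  · exact disjoint_left.2 fun z hz hz' => hz' (interior_subset hz)
  · intro z hz
    by_cases hzN : z ∈ range Ψ
    · exact Or.inl (mem_interior_iff_mem_nhds.2 (hopen z hzN hz))
    · exact Or.inr hzN

end IsGraphRegionMap

/-! ### The normal form of a developing map -/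

/-- A continuous, locally injective function on an interval has no local extremum in its
interior, so it is injective. -/
lemma injOn_of_locally_injOn {f : ℝ → ℝ} {S : Set ℝ} (hS : S.OrdConnected)
    (hf : ContinuousOn f S) (hl : ∀ x ∈ S, ∃ U ∈ 𝓝 x, InjOn f (U ∩ S)) : InjOn f S := by
  have key : ∀ a ∈ S, ∀ b ∈ S, a < b → f a ≠ f b := by
    intro a ha b hb hab he
    have hsub : Icc a b ⊆ S := hS.out ha hb
    obtain ⟨c, hc, hext⟩ := exists_isLocalExtr_Ioo hab (hf.mono hsub) he
    obtain ⟨U, hU, hinj⟩ := hl c (hsub (Ioo_subset_Icc_self hc))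
    obtain ⟨ε, hε, hball⟩ := Metric.nhds_basis_closedBall.mem_iff.1
      (inter_mem hU (Ioo_mem_nhds hc.1 hc.2))
    rw [Real.closedBall_eq_Icc] at hball
    have hsub' : Icc (c - ε) (c + ε) ⊆ U ∩ S := fun x hx =>
      ⟨(hball hx).1, hsub (Ioo_subset_Icc_self (hball hx).2)⟩
    have hmono := ContinuousOn.strictMonoOn_of_injOn_Icc' (by linarith : c - ε ≤ c + ε)
      (hf.mono fun x hx => (hsub' hx).2) (hinj.mono hsub')
    have hcm : c ∈ Icc (c - ε) (c + ε) := ⟨by linarith, by linarith⟩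
    have right : ∀ {p : ℝ → Prop}, (∀ᶠ x in 𝓝 c, p x) → ∃ x ∈ Icc (c - ε) (c + ε), c < x ∧ p x := by
      intro p hp
      obtain ⟨x, hx, hx'⟩ := ((hp.filter_mono nhdsWithin_le_nhds).and
        (Ioo_mem_nhdsGT (by linarith : c < c + ε))).exists
      exact ⟨x, ⟨by linarith [hx'.1], hx'.2.le⟩, hx'.1, hx⟩
    have left : ∀ {p : ℝ → Prop}, (∀ᶠ x in 𝓝 c, p x) → ∃ x ∈ Icc (c - ε) (c + ε), x < c ∧ p x := by
      intro p hp
      obtain ⟨x, hx, hx'⟩ := ((hp.filter_mono nhdsWithin_le_nhds).and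
        (Ioo_mem_nhdsLT (by linarith : c - ε < c))).exists
      exact ⟨x, ⟨hx'.1.le, by linarith [hx'.2]⟩, hx'.2, hx⟩
    rcases hext with hmin | hmax <;> rcases hmono with hm | hm
    · obtain ⟨x, hx, hlt, hp⟩ := left hmin; exact absurd (hm hx hcm hlt) hp.not_gt
    · obtain ⟨x, hx, hlt, hp⟩ := right hmin; exact absurd (hm hcm hx hlt) hp.not_gt
    · obtain ⟨x, hx, hlt, hp⟩ := right hmax; exact absurd (hm hcm hx hlt) hp.not_gt
    · obtain ⟨x, hx, hlt, hp⟩ := left hmax; exact absurd (hm hx hcm hlt) hp.not_gt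
  intro a ha b hb he
  rcases lt_trichotomy a b with h | h | h
  · exact absurd he (key a ha b hb h)
  · exact h
  · exact absurd he.symm (key b hb a ha h)

/-- A boundary arc that develops into a hyperbolic line does so injectively: read through an
isometric parametrization of the line, it is a continuous and injective function. -/
lemma exists_line_coordinate {D : Strip → ℍ} (hD : Continuous D)
    (hinj : ∀ x, ∃ U ∈ 𝓝 x, InjOn D U) {e : ℝ → ℍ} (he : Isometry e) {S : Set ℝ}
    (hS : S.OrdConnected) (t : unitInterval) (hmem : ∀ s ∈ S, D (s, t) ∈ range e) :
    ∃ v : ℝ → ℝ, (∀ s ∈ S, e (v s) = D (s, t)) ∧ ContinuousOn v S ∧ InjOn v S := by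
  choose! v hv using hmem
  have hcont : ContinuousOn v S := by
    rw [he.isEmbedding.isInducing.continuousOn_iff]
    have : ContinuousOn (fun s : ℝ => D (s, t)) S := by fun_prop
    exact this.congr fun s hs => hv s hs
  refine ⟨v, hv, hcont, injOn_of_locally_injOn hS hcont fun s _ => ?_⟩
  obtain ⟨U, hU, hUinj⟩ := hinj (s, t)
  have hc : Continuous (fun s : ℝ => ((s, t) : Strip)) := by fun_prop
  refine ⟨_, hc.continuousAt.preimage_mem_nhds hU, ?_⟩
  intro a ha b hb hab
  have := hUinj ha.1 hb.1 ((hv a ha.2).symm.trans ((congrArg e hab).trans (hv b hb.2)))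
  exact congrArg Prod.fst this

/-- A developing map for which the cuff develops into the imaginary axis, upwards, the holonomy
is `z ↦ q z` with `1 < q`, and some point of the half-pants develops to the right of the axis. -/
structure IsNormalForm (D : Strip → ℍ) (q : ℝ) : Prop where
  continuous : Continuous D
  locally_injective : ∀ x, ∃ U ∈ 𝓝 x, InjOn D U
  map_nhds_eq : ∀ x : Strip, 0 < x.2 → x.2 < 1 → map D (𝓝 x) = 𝓝 (D x)
  one_lt : 1 < q
  re_add_one : ∀ s t, (D (s + 1, t)).re = q * (D (s, t)).re
  im_add_one : ∀ s t, (D (s + 1, t)).im = q * (D (s, t)).im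
  cuff_re : ∀ s, (D (s, 0)).re = 0
  cuff_strictMono : StrictMono fun s => (D (s, 0)).im
  exists_re_pos : ∃ x, 0 < (D x).re
  zipper_geodesic : ∃ e : ℝ → ℍ, Isometry e ∧ ∀ s ∈ Icc (0 : ℝ) 1, D (s, 1) ∈ range e

/-- The distances to two points of the imaginary axis determine a point up to reflection. -/
lemma im_eq_and_re_sq_eq_of_dist {z w : ℍ} {T₀ T₁ L : ℝ} (hT : T₀ ≠ T₁)
    (h₀ : dist w (axisPoint (T₀ + L)) = dist z (axisPoint T₀))
    (h₁ : dist w (axisPoint (T₁ + L)) = dist z (axisPoint T₁)) :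
    w.im = Real.exp L * z.im ∧ w.re ^ 2 = Real.exp L ^ 2 * z.re ^ 2 := by
  have hw := w.im_pos
  have hz := z.im_pos
  have e0 := congrArg Real.cosh h₀
  have e1 := congrArg Real.cosh h₁
  rw [UpperHalfPlane.cosh_dist', UpperHalfPlane.cosh_dist'] at e0 e1
  simp only [axisPoint_re, axisPoint_im, sub_zero, Real.exp_add] at e0 e1
  have hq := Real.exp_pos L
  have hA := Real.exp_pos T₀
  have hB := Real.exp_pos T₁
  have hne : Real.exp T₀ ≠ Real.exp T₁ := by simpa using hT
  generalize Real.exp L = q at *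
  generalize Real.exp T₀ = A at *
  generalize Real.exp T₁ = B at *
  generalize w.im = y at *
  generalize w.re = x at *
  generalize z.im = y' at *
  generalize z.re = x' at *
  field_simp at e0 e1
  have hsq : A ^ 2 - B ^ 2 ≠ 0 := by
    rw [sq_sub_sq]
    exact mul_ne_zero (by positivity) (sub_ne_zero.2 hne)
  have hy : y = q * y' := by
    have : (A ^ 2 - B ^ 2) * (q * (q * y' - y)) = 0 := by linear_combination e0 - e1
    have := ((mul_eq_zero.1 this).resolve_left hsq)
    have := (mul_eq_zero.1 this).resolve_left hq.ne'
    linarith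
  refine ⟨hy, ?_⟩
  subst hy
  have : y' * (x ^ 2 - q ^ 2 * x' ^ 2) = 0 := by linear_combination e0
  linarith [(mul_eq_zero.1 this).resolve_left hz.ne']

/-- A scaling map on the imaginary axis that fixes the side of one point off the axis is a
scaling map everywhere, and not a glide reflection. -/
lemma re_eq_of_isometry {ψ : ℍ → ℍ} (hψ : Isometry ψ) {q : ℝ} (hq : 0 < q)
    (him : ∀ z, (ψ z).im = q * z.im) (hsq : ∀ z, (ψ z).re ^ 2 = q ^ 2 * z.re ^ 2) {z₀ : ℍ}
    (h₀ : 0 < z₀.re * (ψ z₀).re) (z : ℍ) : (ψ z).re = q * z.re := by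
  have alt : ∀ z, (ψ z).re = q * z.re ∨ (ψ z).re = -(q * z.re) := fun z =>
    sq_eq_sq_iff_eq_or_eq_neg.1 (by rw [hsq]; ring)
  have hz₀ : (ψ z₀).re = q * z₀.re := by
    rcases alt z₀ with h | h
    · exact h
    · rw [h] at h₀; nlinarith [mul_nonneg hq.le (sq_nonneg z₀.re)]
  have hre₀ : z₀.re ≠ 0 := by rintro h; simp [h] at h₀
  rcases alt z with h | h
  · exact h
  · have hd := congrArg Real.cosh (hψ.dist_eq z z₀)
    rw [UpperHalfPlane.cosh_dist', UpperHalfPlane.cosh_dist', him, him, h, hz₀] at hd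
    have h1 := z.im_pos
    have h2 := z₀.im_pos
    field_simp at hd
    have : z₀.re * z.re = 0 := by
      have : (q ^ 2 * 4) * (z₀.re * z.re) = 0 := by linear_combination q ^ 2 * hd
      exact (mul_eq_zero.1 this).resolve_left (by positivity)
    rw [h, (mul_eq_zero.1 this).resolve_left hre₀]
    simp

/-- Close to the cuff, a developing map does not meet the axis again, because the axis is already
covered there by the cuff and the map is locally injective. -/
lemma eventually_re_ne_zero {D : Strip → ℍ} (hD : Continuous D)
    (hinj : ∀ x, ∃ U ∈ 𝓝 x, InjOn D U) {v : ℝ → ℝ} (hv : StrictMono v) (hvc : Continuous v)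
    (hcuff : ∀ s, D (s, 0) = axisPoint (v s)) (s : ℝ) :
    ∀ᶠ x in 𝓝 ((s, 0) : Strip), x.2 = 0 ∨ (D x).re ≠ 0 := by
  obtain ⟨U, hU, hUinj⟩ := hinj (s, 0)
  have hc : Continuous (fun s : ℝ => ((s, 0) : Strip)) := by fun_prop
  obtain ⟨ε, hε, hball⟩ := Metric.nhds_basis_closedBall.mem_iff.1
    (hc.continuousAt.preimage_mem_nhds hU)
  rw [Real.closedBall_eq_Icc] at hball
  have hlog : Continuous fun x => Real.log (D x).im :=
    (UpperHalfPlane.continuous_im.comp hD).log fun x => (D x).im_ne_zero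
  have hnear : ∀ᶠ x in 𝓝 ((s, 0) : Strip), Real.log (D x).im ∈ Icc (v (s - ε)) (v (s + ε)) := by
    apply hlog.continuousAt
    change Icc _ _ ∈ 𝓝 (Real.log (D (s, 0)).im)
    rw [hcuff, axisPoint_im, Real.log_exp]
    exact Icc_mem_nhds (hv (by linarith)) (hv (by linarith))
  filter_upwards [hU, hnear] with x hxU hx
  by_contra hne
  push Not at hne
  obtain ⟨s', hs', he⟩ := intermediate_value_Icc (by linarith) hvc.continuousOn hx
  refine hne.1 (congrArg Prod.snd (hUinj hxU (hball hs') ?_))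
  rw [hcuff, he]
  apply UpperHalfPlane.ext_re_im
  · simpa using hne.2
  · simp [Real.exp_log (D x).im_pos]

theorem HalfPants.exists_normalForm (P : HalfPants) :
    ∃ (φ : ℍ ≃ᵢ ℍ) (q : ℝ), IsNormalForm (fun x => φ (P.dev x)) q := by
  -- Parametrize the line that carries the cuff in the direction of the cuff.
  obtain ⟨e, he, v, hv, hvc, hmono⟩ : ∃ e : ℝ → ℍ, Isometry e ∧ ∃ v : ℝ → ℝ,
      (∀ s, e (v s) = P.dev (s, 0)) ∧ Continuous v ∧ StrictMono v := by
    obtain ⟨e, he, hmem⟩ := P.cuff_geodesic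
    obtain ⟨v, hv, hvc, hvi⟩ := exists_line_coordinate P.continuous_dev P.locally_injective he
      ordConnected_univ 0 (fun s _ => hmem s)
    have hvc' : Continuous v := continuousOn_univ.1 hvc
    rcases hvc'.strictMono_of_inj (injOn_univ.1 hvi) with h | h
    · exact ⟨e, he, v, fun s => hv s (mem_univ s), hvc', h⟩
    · exact ⟨fun t => e (-t), he.comp (IsometryEquiv.neg ℝ).isometry, fun s => -v s,
        fun s => by simpa using hv s (mem_univ s), hvc'.neg, h.neg⟩
  obtain ⟨g, hg⟩ := he.exists_smul_eq_axisPoint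
  set φ₀ : ℍ ≃ᵢ ℍ := IsometryEquiv.constSMul g with hφ₀
  set D₀ : Strip → ℍ := fun x => φ₀ (P.dev x) with hD₀
  have hcuff : ∀ s, D₀ (s, 0) = axisPoint (v s) := fun s => by
    rw [← hg, hv]; rfl
  set ψ : ℍ → ℍ := fun z => φ₀ (P.hol (φ₀.symm z)) with hψ
  have hψi : Isometry ψ := φ₀.isometry.comp (P.hol.isometry.comp φ₀.symm.isometry)
  have hadd : ∀ s t, D₀ (s + 1, t) = ψ (D₀ (s, t)) := fun s t => by
    simp [hD₀, hψ, P.dev_add_one]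
  -- The holonomy translates the axis by `L`.
  set L := v 1 - v 0 with hL
  have hLpos : 0 < L := sub_pos.2 (hmono one_pos)
  have hdist : ∀ s z, dist (ψ z) (axisPoint (v (s + 1))) = dist z (axisPoint (v s)) := fun s z => by
    rw [← hcuff, hadd, hψi.dist_eq, hcuff]
  have hv2 : v (1 + 1) = v 1 + L := by
    have h := hdist 1 (axisPoint (v 0))
    have h0 : ψ (axisPoint (v 0)) = axisPoint (v 1) := by
      rw [← hcuff, ← hadd, hcuff]; simp
    rw [h0, dist_axisPoint, dist_axisPoint, abs_sub_comm, abs_sub_comm (v 0),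
      abs_of_pos hLpos, abs_of_pos (sub_pos.2 (hmono (by norm_num)))] at h
    linarith
  have hψz : ∀ z, (ψ z).im = Real.exp L * z.im ∧ (ψ z).re ^ 2 = Real.exp L ^ 2 * z.re ^ 2 :=
    fun z => im_eq_and_re_sq_eq_of_dist (hmono one_pos).ne
      (by rw [← hdist 0]; congr 2; rw [zero_add]; ring) (by rw [← hdist 1, hv2])
  have hD₀c : Continuous D₀ := φ₀.continuous.comp P.continuous_dev
  have hD₀i : ∀ x, ∃ U ∈ 𝓝 x, InjOn D₀ U := fun x => by
    obtain ⟨U, hU, hi⟩ := P.locally_injective x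
    exact ⟨U, hU, φ₀.injective.comp_injOn hi⟩
  -- A curve at small constant height does not cross the axis, so its end is on the same side.
  obtain ⟨z₀, hz₀⟩ : ∃ z₀ : ℍ, 0 < z₀.re * (ψ z₀).re ∧ ∃ x, D₀ x = z₀ := by
    have hsub : Icc (0 : ℝ) 1 ×ˢ ({0} : Set unitInterval) ⊆
        interior {x : Strip | x.2 = 0 ∨ (D₀ x).re ≠ 0} := by
      rintro ⟨s, t⟩ ⟨-, rfl⟩
      exact mem_interior_iff_mem_nhds.2 (eventually_re_ne_zero hD₀c hD₀i hmono hvc hcuff s)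
    obtain ⟨A, B, -, hB, hA', hB', hAB⟩ := generalized_tube_lemma isCompact_Icc
      isCompact_singleton isOpen_interior hsub
    obtain ⟨c, hc, hcpos⟩ : ∃ c ∈ B, c ≠ 0 := by
      have h1 : ∀ᶠ c in 𝓝[≠] (0 : unitInterval), c ∈ B :=
        nhdsWithin_le_nhds (hB.mem_nhds (hB' rfl))
      obtain ⟨c, h2, h3⟩ := (h1.and self_mem_nhdsWithin).exists
      exact ⟨c, h2, h3⟩
    have hne : ∀ s ∈ Icc (0 : ℝ) 1, (D₀ (s, c)).re ≠ 0 := fun s hs =>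
      (interior_subset (hAB ⟨hA' hs, hc⟩)).resolve_left hcpos
    refine ⟨D₀ (0, c), ?_, _, rfl⟩
    rw [← hadd, zero_add]
    have hcont : ContinuousOn (fun s : ℝ => (D₀ (s, c)).re) (Icc 0 1) :=
      (UpperHalfPlane.continuous_re.comp (hD₀c.comp (by fun_prop))).continuousOn
    by_contra hneg
    push Not at hneg
    have h0 := hne 0 (by simp)
    have h1 := hne 1 (by simp)
    have : (0 : ℝ) ∈ (fun s : ℝ => (D₀ (s, c)).re) '' Icc 0 1 := by
      rcases lt_or_gt_of_ne h0 with h | h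
      · exact intermediate_value_Icc zero_le_one hcont ⟨h.le, by nlinarith⟩
      · exact intermediate_value_Icc' zero_le_one hcont ⟨by nlinarith, h.le⟩
    obtain ⟨s, hs, h⟩ := this
    exact hne s hs h
  obtain ⟨hz₀, x₀, hx₀⟩ := hz₀
  have hψre := re_eq_of_isometry hψi (Real.exp_pos L) (fun z => (hψz z).1) (fun z => (hψz z).2) hz₀
  have hre₀ : z₀.re ≠ 0 := by rintro h; simp [h] at hz₀
  obtain ⟨R, σ, hRre, hRim, hσ⟩ : ∃ (R : ℍ ≃ᵢ ℍ) (σ : ℝ), (∀ z, (R z).re = σ * z.re) ∧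
      (∀ z, (R z).im = z.im) ∧ 0 < σ * z₀.re := by
    rcases lt_or_gt_of_ne hre₀ with h | h
    · exact ⟨axisReflection, -1, fun z => by simp, fun z => by simp, by linarith⟩
    · exact ⟨IsometryEquiv.refl ℍ, 1, fun z => (one_mul _).symm, fun z => rfl, by linarith⟩
  refine ⟨φ₀.trans R, Real.exp L, ?_⟩
  have hcomp : ∀ x, (φ₀.trans R) (P.dev x) = R (D₀ x) := fun x => rfl
  refine ⟨(φ₀.trans R).continuous.comp P.continuous_dev, fun x => ?_, fun x h0 h1 => ?_,
    Real.one_lt_exp_iff.2 hLpos, fun s t => ?_, fun s t => ?_, fun s => ?_, fun s s' h => ?_,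
    ⟨x₀, ?_⟩, ?_⟩
  · obtain ⟨U, hU, hi⟩ := P.locally_injective x
    exact ⟨U, hU, (φ₀.trans R).injective.comp_injOn hi⟩
  · have h := (φ₀.trans R).toHomeomorph.map_nhds_eq (P.dev x)
    rw [← P.isLocalHomeomorphOn_interior.map_nhds_eq (x := x) ⟨h0, h1⟩, map_map] at h
    exact h
  · rw [hcomp, hcomp, hRre, hRre, hadd, hψre]; ring
  · rw [hcomp, hcomp, hRim, hRim, hadd, (hψz _).1]
  · rw [hcomp, hRre, hcuff]; simp
  · simp only [hcomp, hRim, hcuff, axisPoint_im]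
    exact Real.exp_lt_exp.2 (hmono h)
  · rw [hcomp, hx₀, hRre]; exact hσ
  · obtain ⟨e, he, hmem⟩ := P.zipper_geodesic
    refine ⟨fun t => (φ₀.trans R) (e t), (φ₀.trans R).isometry.comp he, fun s hs => ?_⟩
    obtain ⟨t, ht⟩ := hmem s hs
    exact ⟨t, by rw [← ht]⟩

/-! ### Coordinates along the axis and the zipper as a graph -/

/-- The quotient `Re z / Im z`, the hyperbolic sine of the signed distance of `z` from the
imaginary axis. -/
noncomputable def height (z : ℍ) : ℝ := z.re / z.im

lemma continuous_height : Continuous height :=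
  UpperHalfPlane.continuous_re.div UpperHalfPlane.continuous_im fun z => z.im_ne_zero

/-- The coordinates `(log |z|², Re z / Im z)` of the upper half-plane, adapted to the imaginary
axis: scalings of the half-plane become translations of the first coordinate. -/
noncomputable def axisCoordinates : ℍ ≃ₜ ℝ × ℝ where
  toFun z := (Real.log (modSq z), height z)
  invFun y := ⟨⟨√(Real.exp y.1 / (1 + y.2 ^ 2)) * y.2, √(Real.exp y.1 / (1 + y.2 ^ 2))⟩,
    Real.sqrt_pos.2 (by positivity)⟩
  left_inv z := by
    have hz := z.im_pos
    have : √(Real.exp (Real.log (modSq z)) / (1 + height z ^ 2)) = z.im := by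
      rw [Real.exp_log (modSq_pos z), ← Real.sqrt_sq hz.le]
      congr 1
      simp only [modSq, height]
      field_simp
      ring
    apply UpperHalfPlane.ext_re_im
    · change √(Real.exp (Real.log (modSq z)) / (1 + height z ^ 2)) * height z = z.re
      rw [this, height]
      field_simp
    · simp only [UpperHalfPlane.mk_im, this]
  right_inv y := by
    have h : 0 < Real.exp y.1 / (1 + y.2 ^ 2) := by positivity
    have h' := Real.sqrt_pos.2 h
    ext
    · simp only [modSq, UpperHalfPlane.mk_re, UpperHalfPlane.mk_im]
      rw [mul_pow, Real.sq_sqrt h.le, show Real.exp y.1 / (1 + y.2 ^ 2) * y.2 ^ 2 +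
        Real.exp y.1 / (1 + y.2 ^ 2) = Real.exp y.1 by field_simp; ring, Real.log_exp]
    · simp only [height, UpperHalfPlane.mk_re, UpperHalfPlane.mk_im]
      field_simp
  continuous_toFun := (continuous_modSq.log fun z => (modSq_pos z).ne').prodMk continuous_height
  continuous_invFun := by
    rw [UpperHalfPlane.isEmbedding_coe.continuous_iff]
    have : Continuous fun y : ℝ × ℝ => √(Real.exp y.1 / (1 + y.2 ^ 2)) :=
      (Continuous.div (by fun_prop) (by fun_prop) (fun y => by positivity)).sqrt
    exact Complex.equivRealProdCLM.symm.continuous.comp ((this.mul continuous_snd).prodMk this)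

@[simp] lemma axisCoordinates_fst (z : ℍ) : (axisCoordinates z).1 = Real.log (modSq z) := rfl

@[simp] lemma axisCoordinates_snd (z : ℍ) : (axisCoordinates z).2 = height z := rfl

/-- A hyperbolic line is a Euclidean circle or line orthogonal to the real axis. -/
lemma Isometry.exists_circle_equation {e : ℝ → ℍ} (he : Isometry e) :
    ∃ α β δ : ℝ, β ^ 2 - 4 * α * δ = 1 ∧ ∀ t, α * modSq (e t) + β * (e t).re + δ = 0 := by
  obtain ⟨g, hg⟩ := he.exists_smul_eq_axisPoint
  have hdet := g.det_coe
  rw [Matrix.det_fin_two] at hdet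
  refine ⟨g 0 0 * g 1 0, g 0 0 * g 1 1 + g 0 1 * g 1 0, g 0 1 * g 1 1, ?_, fun t => ?_⟩
  · linear_combination (g 0 0 * g 1 1 - g 0 1 * g 1 0 + 1) * hdet
  · have h := congrArg UpperHalfPlane.re (hg t)
    rw [specialLinear_smul_re, axisPoint_re, div_eq_zero_iff] at h
    have hy := (g • e t).im_pos
    rw [specialLinear_smul_im] at hy
    have hne : (g 1 0 * (e t).re + g 1 1) ^ 2 + (g 1 0 * (e t).im) ^ 2 ≠ 0 := by
      intro h0; rw [h0, div_zero] at hy; exact lt_irrefl _ hy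
    have h := h.resolve_right hne
    simp only [modSq]
    linear_combination h

/-- A strictly increasing function on a period extends to a strictly increasing function
with `f (s + 1) = f s + ℓ`. -/
lemma strictMono_of_strictMonoOn_Icc {f : ℝ → ℝ} {ℓ : ℝ} (hℓ : 0 ≤ ℓ)
    (hadd : ∀ (s : ℝ) (n : ℤ), f (s + n) = f s + n * ℓ) (hf : StrictMonoOn f (Icc 0 1)) :
    StrictMono f := by
  have hn : ∀ n : ℤ, StrictMonoOn f (Icc n (n + 1)) := by
    intro n a ha b hb hab
    have := hf (a := a - n) (b := b - n) ⟨by linarith [ha.1], by linarith [ha.2]⟩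
      ⟨by linarith [hb.1], by linarith [hb.2]⟩ (by linarith)
    have h1 := hadd (a - n) n
    have h2 := hadd (b - n) n
    rw [sub_add_cancel] at h1 h2
    linarith
  intro s s' hs
  have h1 := Int.floor_le s
  have h2 := Int.lt_floor_add_one s
  have h3 := Int.floor_le s'
  have h4 := Int.lt_floor_add_one s'
  rcases le_or_gt s' (⌊s⌋ + 1) with h | h
  · exact hn ⌊s⌋ ⟨h1, h2.le⟩ ⟨by linarith, h⟩ hs
  · have hle : ⌊s⌋ + 1 ≤ ⌊s'⌋ := Int.le_floor.2 (by push_cast; exact h.le)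
    have e1 : f s < f (⌊s⌋ + 1) := hn ⌊s⌋ ⟨h1, h2.le⟩ ⟨by linarith, le_rfl⟩ h2
    have e2 : f (⌊s⌋ + 1) ≤ f ⌊s'⌋ := by
      have a1 := hadd 0 (⌊s⌋ + 1)
      have a2 := hadd 0 ⌊s'⌋
      rw [zero_add] at a1 a2
      push_cast at a1
      rw [a1, a2]
      have : ((⌊s⌋ : ℝ) + 1) ≤ ⌊s'⌋ := by exact_mod_cast hle
      nlinarith
    have e3 : f ⌊s'⌋ ≤ f s' := (hn ⌊s'⌋).monotoneOn ⟨le_rfl, by linarith⟩ ⟨h3, h4.le⟩ h3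
    linarith

namespace IsNormalForm

variable {D : Strip → ℍ} {q : ℝ}

lemma pos (h : IsNormalForm D q) : 0 < q := one_pos.trans h.one_lt

lemma re_im_add_int (h : IsNormalForm D q) (s : ℝ) (t : unitInterval) (n : ℤ) :
    (D (s + n, t)).re = q ^ n * (D (s, t)).re ∧ (D (s + n, t)).im = q ^ n * (D (s, t)).im := by
  have hq := h.pos.ne'
  induction n using Int.induction_on with
  | zero => simp
  | succ n ih =>
    have e : s + ((n + 1 : ℤ) : ℝ) = s + (n : ℤ) + 1 := by push_cast; ring
    rw [e, h.re_add_one, h.im_add_one, ih.1, ih.2, zpow_add_one₀ hq]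
    constructor <;> ring
  | pred n ih =>
    have e : s + ((-n : ℤ) : ℝ) = s + ((-n - 1 : ℤ) : ℝ) + 1 := by push_cast; ring
    rw [e, h.re_add_one, h.im_add_one] at ih
    have hz : q ^ (-n : ℤ) = q * q ^ (-n - 1 : ℤ) := by
      rw [zpow_sub_one₀ hq]; field_simp
    rw [hz, mul_assoc, mul_assoc] at ih
    exact ⟨mul_left_cancel₀ hq ih.1, mul_left_cancel₀ hq ih.2⟩

lemma modSq_add_int (h : IsNormalForm D q) (s : ℝ) (t : unitInterval) (n : ℤ) :
    modSq (D (s + n, t)) = (q ^ n) ^ 2 * modSq (D (s, t)) := by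
  simp only [modSq, h.re_im_add_int]; ring

lemma height_add_int (h : IsNormalForm D q) (s : ℝ) (t : unitInterval) (n : ℤ) :
    height (D (s + n, t)) = height (D (s, t)) := by
  simp only [height, h.re_im_add_int]
  exact mul_div_mul_left _ _ (zpow_ne_zero n h.pos.ne')

lemma height_add_one (h : IsNormalForm D q) (s : ℝ) (t : unitInterval) :
    height (D (s + 1, t)) = height (D (s, t)) := by
  simpa using h.height_add_int s t 1

/-- The equation of the line through `p = D (0, 1)` and `q p`, on which the zipper lies. -/
lemma zipper_equation (h : IsNormalForm D q) {s : ℝ} (hs : s ∈ Icc (0 : ℝ) 1) :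
    (D (0, 1)).re * (modSq (D (s, 1)) + q * modSq (D (0, 1))) =
      (1 + q) * modSq (D (0, 1)) * (D (s, 1)).re := by
  obtain ⟨e, he, hmem⟩ := h.zipper_geodesic
  obtain ⟨α, β, δ, hdisc, heq⟩ := he.exists_circle_equation
  have key : ∀ s ∈ Icc (0 : ℝ) 1, α * modSq (D (s, 1)) + β * (D (s, 1)).re + δ = 0 := by
    intro s hs
    obtain ⟨t, ht⟩ := hmem s hs
    rw [← ht, heq]
  have k0 := key 0 (by simp)
  have k1 := key 1 (by simp)
  have ks := key s hs
  have m1 := h.modSq_add_int 0 1 1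
  have r1 := (h.re_im_add_int 0 1 1).1
  simp only [Int.cast_one, zero_add, zpow_one] at m1 r1
  rw [m1, r1] at k1
  have hM := modSq_pos (D (0, 1))
  have hq := h.one_lt
  generalize modSq (D (0, 1)) = m at *
  generalize modSq (D (s, 1)) = m' at *
  generalize (D (0, 1)).re = a at *
  generalize (D (s, 1)).re = x at *
  have e1 : β * a = -(α * (q + 1) * m) := by
    have : (q - 1) * (β * a + α * (q + 1) * m) = 0 := by linear_combination k1 - k0
    linarith [(mul_eq_zero.1 this).resolve_left (by linarith)]
  have e2 : δ = α * q * m := by linear_combination k0 - e1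
  have f1 : α * (a * (m' + q * m) - (1 + q) * m * x) = 0 := by
    linear_combination a * ks - x * e1 - a * e2
  rcases mul_eq_zero.1 f1 with h0 | h0
  · subst h0
    have hβ : β ≠ 0 := by rintro rfl; norm_num at hdisc
    have ha : a = 0 := by simpa [hβ] using e1
    have hx : x = 0 := by
      rw [e2] at ks; simpa [hβ] using ks
    simp [ha, hx]
  · linarith

lemma map_axisCoordinates_nhds (h : IsNormalForm D q) {x : Strip} (h0 : 0 < x.2) (h1 : x.2 < 1) :
    map (fun x => axisCoordinates (D x)) (𝓝 x) = 𝓝 (axisCoordinates (D x)) := by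
  rw [← axisCoordinates.map_nhds_eq (D x), ← h.map_nhds_eq x h0 h1, map_map]
  rfl

/-- By the maximum principle the height is largest at a point of the zipper, where it is positive
by the choice of side; hence the cone point lies to the right of the axis. -/
lemma conePoint_re_pos (h : IsNormalForm D q) : 0 < (D (0, 1)).re := by
  obtain ⟨x, hx⟩ := exists_forall_le_of_periodic (G := fun x => height (D x))
    (continuous_height.comp h.continuous) h.height_add_one
  obtain ⟨y, hy⟩ := h.exists_re_pos
  have hpos : 0 < height (D x) := lt_of_lt_of_le (div_pos hy (D y).im_pos) (hx y)
  rcases unitInterval_cases x.2 with h2 | h2 | h2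
  · rw [show x = (x.1, 0) from Prod.ext rfl h2, height, h.cuff_re] at hpos
    simp at hpos
  · obtain ⟨s, hs, e⟩ := Function.Periodic.exists_mem_Ico₀ (f := fun s => height (D (s, 1)))
      (fun s => h.height_add_one s 1) one_pos x.1
    have hxs : x = (x.1, 1) := Prod.ext rfl h2
    rw [hxs] at hpos
    rw [show height (D (x.1, 1)) = height (D (s, 1)) from e] at hpos
    have hre : 0 < (D (s, 1)).re := (div_pos_iff_of_pos_right (D (s, 1)).im_pos).1 hpos
    have heq := h.zipper_equation (Ico_subset_Icc_self hs)
    have h1 := modSq_pos (D (0, 1))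
    have h3 := modSq_pos (D (s, 1))
    have hq := h.pos
    have : 0 < (D (0, 1)).re * (modSq (D (s, 1)) + q * modSq (D (0, 1))) := by
      rw [heq]; positivity
    exact (pos_iff_pos_of_mul_pos this).2 (by positivity)
  · have : ∀ᶠ y in 𝓝 (axisCoordinates (D x)), y.2 ≤ height (D x) := by
      rw [← h.map_axisCoordinates_nhds h2.1 h2.2, eventually_map]
      exact Eventually.of_forall hx
    obtain ⟨ε, hε, h3, -⟩ := exists_vertical_of_eventually this
    simp only [axisCoordinates_snd] at h3
    linarith

lemma zipper_height_pos (h : IsNormalForm D q) (s : ℝ) : 0 < height (D (s, 1)) := by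
  obtain ⟨s', hs, e⟩ := Function.Periodic.exists_mem_Ico₀ (f := fun s => height (D (s, 1)))
    (fun s => h.height_add_one s 1) one_pos s
  rw [show height (D (s, 1)) = height (D (s', 1)) from e]
  refine div_pos ?_ (D (s', 1)).im_pos
  have heq := h.zipper_equation (Ico_subset_Icc_self hs)
  have h1 := modSq_pos (D (0, 1))
  have h3 := modSq_pos (D (s', 1))
  have hq := h.pos
  have hp := h.conePoint_re_pos
  have : 0 < (1 + q) * modSq (D (0, 1)) * (D (s', 1)).re := by
    rw [← heq]; positivity
  exact (pos_iff_pos_of_mul_pos this).1 (by positivity)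

lemma continuous_log_modSq (h : IsNormalForm D q) : Continuous fun x => Real.log (modSq (D x)) :=
  (continuous_modSq.comp h.continuous).log fun _ => (modSq_pos _).ne'

lemma log_modSq_add_int (h : IsNormalForm D q) (s : ℝ) (t : unitInterval) (n : ℤ) :
    Real.log (modSq (D (s + n, t))) = Real.log (modSq (D (s, t))) + n * Real.log (q ^ 2) := by
  have hq := h.pos
  rw [h.modSq_add_int, Real.log_mul (by positivity) (modSq_pos _).ne', ← zpow_natCast,
    zpow_comm, zpow_natCast, Real.log_zpow]
  ring

lemma log_sq_pos (h : IsNormalForm D q) : 0 < Real.log (q ^ 2) :=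
  Real.log_pos (one_lt_pow₀ h.one_lt two_ne_zero)

lemma strictMono_zipper (h : IsNormalForm D q) :
    StrictMono fun s => Real.log (modSq (D (s, 1))) := by
  have hcont : Continuous fun s : ℝ => Real.log (modSq (D (s, 1))) :=
    h.continuous_log_modSq.comp (by fun_prop)
  refine strictMono_of_strictMonoOn_Icc h.log_sq_pos.le (fun s n => h.log_modSq_add_int s 1 n) ?_
  obtain ⟨e, he, hmem⟩ := h.zipper_geodesic
  obtain ⟨v, hv, -, hvi⟩ := exists_line_coordinate h.continuous h.locally_injective he
    ordConnected_Icc 1 hmem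
  refine ContinuousOn.strictMonoOn_of_injOn_Icc zero_le_one ?_ hcont.continuousOn ?_
  · have := h.log_modSq_add_int 0 1 1
    simp only [Int.cast_one, zero_add, one_mul] at this
    linarith [h.log_sq_pos]
  · intro s hs s' hs' hss
    have hm : modSq (D (s, 1)) = modSq (D (s', 1)) :=
      Real.log_injOn_pos (modSq_pos _) (modSq_pos _) hss
    have hre : (D (s, 1)).re = (D (s', 1)).re := by
      have e1 := h.zipper_equation hs
      have e2 := h.zipper_equation hs'
      rw [hm, e2] at e1
      have h1 := modSq_pos (D (0, 1))
      have hq := h.pos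
      exact (mul_left_cancel₀ (by positivity) e1).symm
    have him : (D (s, 1)).im = (D (s', 1)).im := by
      simp only [modSq, hre, add_right_inj] at hm
      exact (pow_left_inj₀ (D (s, 1)).im_pos.le (D (s', 1)).im_pos.le two_ne_zero).1 hm
    apply hvi hs hs'
    apply he.injective
    rw [hv s hs, hv s' hs', UpperHalfPlane.ext_re_im hre him]

lemma surjective_zipper (h : IsNormalForm D q) :
    Function.Surjective fun s => Real.log (modSq (D (s, 1))) := by
  have hcont : Continuous fun s : ℝ => Real.log (modSq (D (s, 1))) :=
    h.continuous_log_modSq.comp (by fun_prop)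
  have hℓ := h.log_sq_pos
  intro c
  have hn : ∀ n : ℤ, Real.log (modSq (D ((n : ℝ), 1))) =
      Real.log (modSq (D (0, 1))) + n * Real.log (q ^ 2) := fun n => by
    rw [← h.log_modSq_add_int 0 1 n, zero_add]
  apply mem_range_of_exists_le_of_exists_ge hcont
  · refine ⟨(⌊(c - Real.log (modSq (D (0, 1)))) / Real.log (q ^ 2)⌋ : ℤ), ?_⟩
    rw [hn]
    have := (le_div_iff₀ hℓ).1 (Int.floor_le ((c - Real.log (modSq (D (0, 1)))) / Real.log (q ^ 2)))
    linarith
  · refine ⟨(⌈(c - Real.log (modSq (D (0, 1)))) / Real.log (q ^ 2)⌉ : ℤ), ?_⟩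
    rw [hn]
    have := (div_le_iff₀ hℓ).1 (Int.le_ceil ((c - Real.log (modSq (D (0, 1)))) / Real.log (q ^ 2)))
    linarith

/-- The parametrization of the developed zipper by `log |z|²`. -/
noncomputable def zipperOrderIso (h : IsNormalForm D q) : ℝ ≃o ℝ :=
  h.strictMono_zipper.orderIsoOfSurjective _ h.surjective_zipper

lemma zipperOrderIso_apply (h : IsNormalForm D q) (s : ℝ) :
    h.zipperOrderIso s = Real.log (modSq (D (s, 1))) := rfl

/-- The developed zipper as a graph: its height as a function of `log |z|²`. -/
noncomputable def zipperGraph (h : IsNormalForm D q) (τ : ℝ) : ℝ :=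
  height (D (h.zipperOrderIso.symm τ, 1))

lemma zipperGraph_log_modSq (h : IsNormalForm D q) (s : ℝ) :
    h.zipperGraph (Real.log (modSq (D (s, 1)))) = height (D (s, 1)) := by
  rw [zipperGraph, ← h.zipperOrderIso_apply, OrderIso.symm_apply_apply]

lemma isGraphRegionMap (h : IsNormalForm D q) :
    IsGraphRegionMap (fun x => axisCoordinates (D x)) (Real.log (q ^ 2)) h.zipperGraph where
  continuous := axisCoordinates.continuous.comp h.continuous
  locally_injective x := by
    obtain ⟨U, hU, hi⟩ := h.locally_injective x
    exact ⟨U, hU, axisCoordinates.injective.comp_injOn hi⟩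
  map_nhds_eq x h0 h1 := h.map_axisCoordinates_nhds h0 h1
  add_one s t := by
    have := h.log_modSq_add_int s t 1
    simp only [Int.cast_one, one_mul] at this
    ext
    · simpa using this
    · simpa using h.height_add_one s t
  translation_pos := h.log_sq_pos
  continuous_graph := continuous_height.comp
    (h.continuous.comp (h.zipperOrderIso.symm.continuous.prodMk continuous_const))
  graph_pos τ := h.zipper_height_pos _
  graph_add τ := by
    obtain ⟨s, rfl⟩ := h.surjective_zipper τ
    have := h.log_modSq_add_int s 1 1
    simp only [Int.cast_one, one_mul] at this
    simp only
    rw [← this, h.zipperGraph_log_modSq, h.zipperGraph_log_modSq, h.height_add_one]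
  bottom s := by simp [height, h.cuff_re]
  top s := by simp [h.zipperGraph_log_modSq]
  bottom_injective s s' he := by
    have hm := Real.log_injOn_pos (modSq_pos _) (modSq_pos _) he
    simp only [modSq, h.cuff_re] at hm
    apply h.cuff_strictMono.injective
    exact (pow_left_inj₀ (D (s, 0)).im_pos.le (D (s', 0)).im_pos.le two_ne_zero).1 (by simpa using hm)
  top_injective := h.strictMono_zipper.injective

end IsNormalForm

/-! ### Rays asymptotic to the axis -/

/-- The unit-speed ray that starts at `p` and runs vertically upwards. -/
noncomputable def verticalRay (p : ℍ) (t : ℝ≥0) : ℍ :=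
  ⟨⟨p.re, p.im * Real.exp t⟩, mul_pos p.im_pos (Real.exp_pos _)⟩

@[simp] lemma verticalRay_re (p : ℍ) (t : ℝ≥0) : (verticalRay p t).re = p.re := rfl

@[simp] lemma verticalRay_im (p : ℍ) (t : ℝ≥0) :
    (verticalRay p t).im = p.im * Real.exp t := rfl

lemma verticalRay_zero (p : ℍ) : verticalRay p 0 = p := by
  apply UpperHalfPlane.ext_re_im <;> simp

lemma isometry_verticalRay (p : ℍ) : Isometry (verticalRay p) :=
  Isometry.of_dist_eq fun s t => by
    rw [UpperHalfPlane.dist_of_re_eq (by simp), verticalRay_im, verticalRay_im,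
      Real.log_mul p.im_ne_zero (Real.exp_ne_zero _), Real.log_mul p.im_ne_zero (Real.exp_ne_zero _),
      Real.log_exp, Real.log_exp, dist_add_left, NNReal.dist_eq, Real.dist_eq]

lemma height_verticalRay (p : ℍ) (t : ℝ≥0) :
    height (verticalRay p t) = height p * Real.exp (-t) := by
  rw [height, height, verticalRay_re, verticalRay_im, Real.exp_neg]
  have := p.im_pos
  field_simp

lemma height_inversion (p z : ℍ) : height (inversion p z) = height z := by
  have := (modSq_pos p).ne'
  have := (modSq_pos z).ne'
  rw [height, height, inversion_re, inversion_im]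
  field_simp

lemma modSq_verticalRay (p : ℍ) (t : ℝ≥0) :
    modSq (verticalRay p t) = p.re ^ 2 + p.im ^ 2 * Real.exp t ^ 2 := by
  simp [modSq, mul_pow]

lemma modSq_lt_modSq_verticalRay (p : ℍ) {t : ℝ≥0} (ht : 0 < t) :
    modSq p < modSq (verticalRay p t) := by
  rw [modSq_verticalRay, modSq]
  have h1 : 1 < Real.exp t := Real.one_lt_exp_iff.2 (by exact_mod_cast ht)
  have h2 : 1 < Real.exp t ^ 2 := one_lt_pow₀ h1 two_ne_zero
  have h3 : 0 < p.im ^ 2 := pow_pos p.im_pos 2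
  nlinarith

/-- A geodesic ray that stays at bounded distance from the imaginary axis is asymptotic to one of
the two ends of the axis. -/
lemma eq_verticalRay_or_eq_inversion {e : ℝ≥0 → ℍ} (he : Isometry e) {B : ℝ}
    (hB : ∀ t, |height (e t)| ≤ B) :
    e = verticalRay (e 0) ∨ e = fun t => inversion (e 0) (verticalRay (e 0) t) := by
  obtain ⟨g, hg⟩ := he.exists_smul_eq_axisPoint_nnreal
  have het : ∀ t, e t = g⁻¹ • axisPoint t := fun t => by rw [← hg, inv_smul_smul]
  have hdet := (g⁻¹).det_coe
  rw [Matrix.det_fin_two] at hdet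
  have hre : ∀ t, (e t).re = ((g⁻¹) 0 1 * (g⁻¹) 1 1 + (g⁻¹) 0 0 * (g⁻¹) 1 0 * Real.exp t ^ 2) /
      ((g⁻¹) 1 1 ^ 2 + ((g⁻¹) 1 0 * Real.exp t) ^ 2) := fun t => by
    rw [het, specialLinear_smul_re]; simp
  have him : ∀ t, (e t).im = Real.exp t /
      ((g⁻¹) 1 1 ^ 2 + ((g⁻¹) 1 0 * Real.exp t) ^ 2) := fun t => by
    rw [het, specialLinear_smul_im]; simp
  generalize (g⁻¹ : Matrix.SpecialLinearGroup (Fin 2) ℝ) 0 0 = a at *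
  generalize (g⁻¹ : Matrix.SpecialLinearGroup (Fin 2) ℝ) 0 1 = b at *
  generalize (g⁻¹ : Matrix.SpecialLinearGroup (Fin 2) ℝ) 1 0 = c at *
  generalize (g⁻¹ : Matrix.SpecialLinearGroup (Fin 2) ℝ) 1 1 = d at *
  have hden : ∀ t : ℝ≥0, 0 < d ^ 2 + (c * Real.exp t) ^ 2 := fun t => by
    have h1 := (e t).im_pos
    rw [him] at h1
    exact (div_pos_iff_of_pos_left (Real.exp_pos _)).1 h1
  have hac : a * c = 0 := by
    have hle : ∀ t : ℝ≥0, |a * c| * Real.exp t ≤ B + |b * d| := by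
      intro t
      have hE := Real.exp_pos t
      have hE1 : 1 ≤ Real.exp t := Real.one_le_exp t.2
      have h1 := hB t
      have h2 : height (e t) = b * d / Real.exp t + a * c * Real.exp t := by
        have hN := (hden t).ne'
        rw [height, hre, him]
        generalize d ^ 2 + (c * Real.exp t) ^ 2 = N at hN ⊢
        field_simp
      rw [h2] at h1
      calc |a * c| * Real.exp t = |(b * d / Real.exp t + a * c * Real.exp t)
            - b * d / Real.exp t| := by
            rw [add_sub_cancel_left, abs_mul (a * c), abs_of_pos hE]
        _ ≤ B + |b * d / Real.exp t| := (abs_sub _ _).trans (by linarith)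
        _ ≤ B + |b * d| := by
            rw [abs_div, abs_of_pos hE]
            linarith [div_le_self (abs_nonneg (b * d)) hE1]
    by_contra hne
    have hpos : 0 < |a * c| := abs_pos.2 hne
    have hX : 0 ≤ (B + |b * d|) / |a * c| :=
      div_nonneg (add_nonneg ((abs_nonneg _).trans (hB 0)) (abs_nonneg _)) hpos.le
    obtain ⟨t, ht⟩ : ∃ t : ℝ≥0, (t : ℝ) = (B + |b * d|) / |a * c| := ⟨⟨_, hX⟩, rfl⟩
    have h1 := hle t
    have h2 := Real.add_one_le_exp (t : ℝ)
    have h3 : |a * c| * t = B + |b * d| := by rw [ht]; field_simp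
    nlinarith
  have hM := hden 0
  have hre0 := hre 0
  have him0 := him 0
  simp only [NNReal.coe_zero, Real.exp_zero, mul_one, one_pow] at hM hre0 him0
  rcases mul_eq_zero.1 hac with h0 | h0
  · right
    subst h0
    have hbc : b * c = -1 := by linear_combination -hdet
    have hb : b ≠ 0 := by rintro rfl; simp at hbc
    have hbc2 : b ^ 2 * c ^ 2 = 1 := by linear_combination (b * c - 1) * hbc
    have hm : ∀ t, modSq (e t) = b ^ 2 / (d ^ 2 + (c * Real.exp t) ^ 2) := fun t => by
      have hN := (hden t).ne'
      obtain ⟨N, hNd⟩ : ∃ N, N = d ^ 2 + (c * Real.exp t) ^ 2 := ⟨_, rfl⟩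
      rw [← hNd] at hN
      rw [modSq, hre, him, ← hNd]
      field_simp
      rw [hNd]
      linear_combination - Real.exp t ^ 2 * hbc2
    have hm0 := hm 0
    simp only [NNReal.coe_zero, Real.exp_zero, mul_one] at hm0
    funext t
    rw [← inversion_inversion (e 0) (e t)]
    congr 1
    have hN := (hden t).ne'
    apply UpperHalfPlane.ext_re_im
    · rw [inversion_re, verticalRay_re, hm t, hm0, hre t, hre0]
      generalize d ^ 2 + (c * Real.exp t) ^ 2 = N at hN ⊢
      field_simp
      ring
    · rw [inversion_im, verticalRay_im, hm t, hm0, him t, him0]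
      generalize d ^ 2 + (c * Real.exp t) ^ 2 = N at hN ⊢
      field_simp
  · left
    subst h0
    have hd : d ≠ 0 := by rintro rfl; simp at hdet
    funext t
    apply UpperHalfPlane.ext_re_im
    · rw [verticalRay_re, hre, hre0]; simp
    · rw [verticalRay_im, him, him0]; simp; field_simp

namespace IsNormalForm

variable {D : Strip → ℍ} {q : ℝ}

lemma injective (h : IsNormalForm D q) : Function.Injective D :=
  .of_comp (f := axisCoordinates) h.isGraphRegionMap.injective

/-- To lie below the zipper graph it suffices to lie to the left of the point of the developed
zipper of the same modulus. -/
lemma axisCoordinates_mem_graphRegion (h : IsNormalForm D q) {z : ℍ} (hz : 0 < z.re)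
    (hlt : ∀ s, modSq z = modSq (D (s, 1)) → z.re < (D (s, 1)).re) :
    axisCoordinates z ∈ graphRegion h.zipperGraph := by
  refine ⟨div_pos hz z.im_pos, ?_⟩
  obtain ⟨s, hs⟩ := h.surjective_zipper (Real.log (modSq z))
  have hm : modSq (D (s, 1)) = modSq z := Real.log_injOn_pos (modSq_pos _) (modSq_pos _) hs
  have hre := hlt s hm.symm
  rw [axisCoordinates_fst, ← hs, h.zipperGraph_log_modSq, axisCoordinates_snd, height, height]
  have hi := z.im_pos
  have hi' := (D (s, 1)).im_pos
  have him : (D (s, 1)).im < z.im := by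
    simp only [modSq] at hm
    nlinarith
  exact div_lt_div₀ hre him.le (hz.trans hre).le hi'

/-- Every point of the developed zipper is a scaling of a point over the fundamental period,
whose modulus lies between those of the cone point and of its first translate. -/
lemma exists_zipper_period (h : IsNormalForm D q) (s : ℝ) : ∃ (n : ℤ) (m x : ℝ),
    modSq (D (s, 1)) = (q ^ n) ^ 2 * m ∧ (D (s, 1)).re = q ^ n * x ∧
    modSq (D (0, 1)) ≤ m ∧ m < q ^ 2 * modSq (D (0, 1)) ∧
    (D (0, 1)).re * (m + q * modSq (D (0, 1))) = (1 + q) * modSq (D (0, 1)) * x ∧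
    (0 < s → 0 ≤ n) ∧ (s < 0 → n < 0) := by
  have hs : s = Int.fract s + ⌊s⌋ := (Int.fract_add_floor s).symm
  refine ⟨⌊s⌋, modSq (D (Int.fract s, 1)), (D (Int.fract s, 1)).re, ?_, ?_, ?_, ?_,
    h.zipper_equation ⟨Int.fract_nonneg s, (Int.fract_lt_one s).le⟩,
    fun h0 => Int.floor_nonneg.2 h0.le, fun h0 => Int.floor_lt.2 (by simpa using h0)⟩
  · rw [← h.modSq_add_int, ← hs]
  · rw [← (h.re_im_add_int _ _ _).1, ← hs]
  · exact (Real.log_le_log_iff (modSq_pos _) (modSq_pos _)).1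
      (h.strictMono_zipper.monotone (Int.fract_nonneg s))
  · have h1 := h.modSq_add_int 0 1 1
    simp only [zero_add, Int.cast_one, zpow_one] at h1
    rw [← h1]
    exact (Real.log_lt_log_iff (modSq_pos _) (modSq_pos _)).1
      (h.strictMono_zipper (Int.fract_lt_one s))

lemma lt_iff_modSq_zipper_lt (h : IsNormalForm D q) {s s' : ℝ} :
    modSq (D (s, 1)) < modSq (D (s', 1)) ↔ s < s' := by
  rw [← Real.log_lt_log_iff (modSq_pos _) (modSq_pos _)]
  exact h.strictMono_zipper.lt_iff_lt

lemma verticalRay_mem_graphRegion (h : IsNormalForm D q) {t : ℝ≥0} (ht : 0 < t) :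
    axisCoordinates (verticalRay (D (0, 1)) t) ∈ graphRegion h.zipperGraph := by
  have ha := h.conePoint_re_pos
  refine h.axisCoordinates_mem_graphRegion (by simpa using ha) fun s hs => ?_
  have hlt := modSq_lt_modSq_verticalRay (D (0, 1)) ht
  rw [hs] at hlt
  have hs0 : 0 < s := h.lt_iff_modSq_zipper_lt.1 hlt
  obtain ⟨n, m, x, e1, e2, h1, -, e3, hn, -⟩ := h.exists_zipper_period s
  have hM := modSq_pos (D (0, 1))
  have hq := h.one_lt
  rw [verticalRay_re, e2]
  rw [e1] at hlt
  have hx : (D (0, 1)).re ≤ x := by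
    by_contra! hx
    nlinarith [mul_lt_mul_of_pos_left hx (by positivity : 0 < (1 + q) * modSq (D (0, 1)))]
  rcases (hn hs0).eq_or_lt with h0 | h0
  · subst h0
    simp only [zpow_zero, one_pow, one_mul] at hlt ⊢
    by_contra! hx
    nlinarith [mul_le_mul_of_nonneg_left hx
      (by positivity : 0 ≤ (1 + q) * modSq (D (0, 1)))]
  · have : 1 < q ^ n := one_lt_zpow₀ hq h0
    nlinarith

lemma inversion_mem_graphRegion (h : IsNormalForm D q) {t : ℝ≥0} (ht : 0 < t) :
    axisCoordinates (inversion (D (0, 1)) (verticalRay (D (0, 1)) t)) ∈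
      graphRegion h.zipperGraph := by
  have ha := h.conePoint_re_pos
  have hM := modSq_pos (D (0, 1))
  have hV := modSq_pos (verticalRay (D (0, 1)) t)
  refine h.axisCoordinates_mem_graphRegion (by rw [inversion_re, verticalRay_re]; positivity)
    fun s hs => ?_
  have hlt : modSq (inversion (D (0, 1)) (verticalRay (D (0, 1)) t)) < modSq (D (0, 1)) := by
    rw [modSq_inversion, div_lt_iff₀ hV, sq]
    exact mul_lt_mul_of_pos_left (modSq_lt_modSq_verticalRay _ ht) hM
  have hre : (inversion (D (0, 1)) (verticalRay (D (0, 1)) t)).re =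
      (D (0, 1)).re * modSq (D (s, 1)) / modSq (D (0, 1)) := by
    rw [← hs, modSq_inversion, inversion_re, verticalRay_re]
    field_simp
  rw [hs] at hlt
  have hs0 : s < 0 := h.lt_iff_modSq_zipper_lt.1 hlt
  obtain ⟨n, m, x, e1, e2, h1, h2, e3, -, hn⟩ := h.exists_zipper_period s
  have hq := h.one_lt
  have hQ : 0 < q ^ n := zpow_pos h.pos n
  have hQ1 : q ^ n * q ≤ 1 := by
    rw [← zpow_add_one₀ h.pos.ne']
    exact zpow_le_one_of_nonpos₀ hq.le (by have := hn hs0; omega)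
  rw [hre, e1, e2, div_lt_iff₀ hM]
  generalize q ^ n = Q at *
  generalize (D (0, 1)).re = a at *
  generalize modSq (D (0, 1)) = M at *
  have hm : 0 < m := hM.trans_le h1
  have key : Q * m * a < M * x := by
    have k1 : (1 + q) * (Q * q * m * a) ≤ (1 + q) * (m * a) := by
      have := mul_le_mul_of_nonneg_right hQ1 (by positivity : 0 ≤ (1 + q) * (m * a))
      linarith
    have k2 : q * ((1 + q) * (M * x)) = a * (q * m) + a * (q ^ 2 * M) := by linear_combination -q * e3
    have k3 : a * m < a * (q ^ 2 * M) := mul_lt_mul_of_pos_left h2 ha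
    have k4 : q * (1 + q) * (Q * m * a) < q * (1 + q) * (M * x) := by linarith
    exact lt_of_mul_lt_mul_left k4 (by positivity)
  nlinarith [mul_lt_mul_of_pos_left key hQ]

/-- A unit-speed geodesic ray of the hyperbolic plane that starts at the developed cone point,
stays inside the developed half-pants, approaches the axis, and visits the orbit of every modulus
under the holonomy at arbitrarily large times. -/
structure IsSpiralDevelopment (h : IsNormalForm D q) (γ : ℝ≥0 → ℍ) : Prop where
  isometry : Isometry γ
  zero : γ 0 = D (0, 1)
  mem_region : ∀ t, 0 < t → axisCoordinates (γ t) ∈ graphRegion h.zipperGraph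
  height_eq : ∀ t : ℝ≥0, height (γ t) = height (D (0, 1)) * Real.exp (-t)
  exists_modSq_eq : ∀ m : ℝ, 0 < m → ∀ T : ℝ≥0, ∃ t ≥ T, ∃ k : ℤ, modSq (γ t) = (q ^ k) ^ 2 * m

lemma exists_modSq_verticalRay_eq (hq : 1 < q) (p : ℍ) {m : ℝ} (hm : 0 < m) (T : ℝ≥0) :
    ∃ t ≥ T, ∃ k : ℤ, modSq (verticalRay p t) = (q ^ k) ^ 2 * m := by
  have hp := p.im_pos
  obtain ⟨n, hn⟩ := pow_unbounded_of_one_lt ((p.re ^ 2 + p.im ^ 2 * Real.exp T ^ 2) / m)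
    (one_lt_pow₀ hq two_ne_zero)
  rw [div_lt_iff₀ hm, ← pow_mul, mul_comm 2 n, pow_mul] at hn
  set X := ((q ^ n) ^ 2 * m - p.re ^ 2) / p.im ^ 2 with hX
  have hXT : Real.exp T ^ 2 < X := by
    rw [hX, lt_div_iff₀ (by positivity)]; linarith
  have hX0 : 0 < X := lt_trans (by positivity) hXT
  have hle : (T : ℝ) ≤ Real.log X / 2 := by
    have := Real.log_le_log (by positivity) hXT.le
    rw [Real.log_pow, Real.log_exp] at this
    push_cast at this
    linarith
  obtain ⟨t, ht⟩ : ∃ t : ℝ≥0, (t : ℝ) = Real.log X / 2 := ⟨⟨_, T.2.trans hle⟩, rfl⟩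
  refine ⟨t, NNReal.coe_le_coe.1 (ht ▸ hle), n, ?_⟩
  rw [modSq_verticalRay, ht, ← Real.exp_nat_mul]
  push_cast
  rw [mul_div_cancel₀ _ two_ne_zero, Real.exp_log hX0, hX, zpow_natCast]
  field_simp
  ring

lemma isSpiralDevelopment_verticalRay (h : IsNormalForm D q) :
    h.IsSpiralDevelopment (verticalRay (D (0, 1))) where
  isometry := isometry_verticalRay _
  zero := verticalRay_zero _
  mem_region _ ht := h.verticalRay_mem_graphRegion ht
  height_eq t := height_verticalRay _ t
  exists_modSq_eq _ hm T := exists_modSq_verticalRay_eq h.one_lt _ hm T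

lemma isSpiralDevelopment_inversion (h : IsNormalForm D q) :
    h.IsSpiralDevelopment fun t => inversion (D (0, 1)) (verticalRay (D (0, 1)) t) where
  isometry := (isometry_inversion _).comp (isometry_verticalRay _)
  zero := by rw [verticalRay_zero, inversion_self]
  mem_region _ ht := h.inversion_mem_graphRegion ht
  height_eq t := by rw [height_inversion, height_verticalRay]
  exists_modSq_eq m hm T := by
    have hM := modSq_pos (D (0, 1))
    obtain ⟨t, ht, k, hk⟩ := exists_modSq_verticalRay_eq h.one_lt (D (0, 1))
      (m := modSq (D (0, 1)) ^ 2 / m) (by positivity) T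
    refine ⟨t, ht, -k, ?_⟩
    have hQ : 0 < q ^ k := zpow_pos h.pos k
    rw [modSq_inversion, hk, zpow_neg]
    field_simp

end IsNormalForm

/-! ### Lifts to the strip and spiral rays -/

lemma Strip.proj_eq_proj_iff {x y : Strip} :
    x.proj = y.proj ↔ ∃ n : ℤ, x = (y.1 + n, y.2) := by
  obtain ⟨a, t⟩ := x
  obtain ⟨b, t'⟩ := y
  simp only [Strip.proj, Prod.mk.injEq]
  rw [← sub_eq_zero, ← AddCircle.coe_sub, AddCircle.coe_eq_zero_iff]
  constructor
  · rintro ⟨⟨n, hn⟩, h⟩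
    rw [zsmul_one] at hn
    exact ⟨n, by linarith, h⟩
  · rintro ⟨n, hn, h⟩
    exact ⟨⟨n, by rw [zsmul_one]; linarith⟩, h⟩

lemma Strip.isOpenQuotientMap_proj : IsOpenQuotientMap Strip.proj :=
  QuotientAddGroup.isOpenQuotientMap_mk.prodMap .id

lemma Strip.isLocallyInjective_proj : IsLocallyInjective Strip.proj := by
  intro x
  obtain ⟨U, hU, hx, hi⟩ := (AddCircle.isLocalHomeomorph_coe (1 : ℝ)).isLocallyInjective x.1
  refine ⟨Prod.fst ⁻¹' U, hU.preimage continuous_fst, hx, fun a ha b hb hab => ?_⟩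
  simp only [Strip.proj, Prod.mk.injEq] at hab
  exact Prod.ext (hi ha hb hab.1) hab.2

/-- Two lifts of a ray to the strip with the same initial point agree. -/
lemma HalfPants.IsGeodesicLift.unique {P : HalfPants} {r : ℝ≥0 → Annulus} {L L' : ℝ≥0 → Strip}
    (hL : P.IsGeodesicLift r L) (hL' : P.IsGeodesicLift r L') (h0 : L 0 = L' 0) : L = L' :=
  (T2Space.isSeparatedMap _).eq_of_comp_eq Strip.isLocallyInjective_proj hL.continuous
    hL'.continuous (funext fun t => (hL.proj_eq t).trans (hL'.proj_eq t).symm) 0 h0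

lemma HalfPants.dev_add_int (P : HalfPants) (n : ℤ) :
    ∃ ψ : ℍ ≃ᵢ ℍ, ∀ x : Strip, P.dev (x.1 + n, x.2) = ψ (P.dev x) := by
  induction n using Int.induction_on with
  | zero => exact ⟨IsometryEquiv.refl ℍ, fun x => by simp; rfl⟩
  | succ n ih =>
    obtain ⟨ψ, hψ⟩ := ih
    refine ⟨ψ.trans P.hol, fun x => ?_⟩
    rw [IsometryEquiv.trans_apply, ← hψ, ← P.dev_add_one]
    push_cast
    rw [add_assoc]
  | pred n ih =>
    obtain ⟨ψ, hψ⟩ := ih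
    refine ⟨ψ.trans P.hol.symm, fun x => ?_⟩
    rw [IsometryEquiv.trans_apply, ← hψ, IsometryEquiv.eq_symm_apply, ← P.dev_add_one]
    push_cast
    congr 2
    ring

/-- A geodesic ray from the cone point has a lift that starts at `(0, 1)`. -/
lemma HalfPants.IsGeodesicRay.exists_lift {P : HalfPants} {r : ℝ≥0 → Annulus}
    (hr : P.IsGeodesicRay r) (h0 : r 0 = HalfPants.conePoint) :
    ∃ L, P.IsGeodesicLift r L ∧ L 0 = (0, 1) := by
  obtain ⟨L, hL⟩ := hr
  have hp : (L 0).proj = Strip.proj (0, 1) := (hL.proj_eq 0).trans h0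
  obtain ⟨n, hn⟩ := Strip.proj_eq_proj_iff.1 hp
  refine ⟨fun t => ((L t).1 + (-n : ℤ), (L t).2), ⟨?_, fun t => ?_, ?_⟩, ?_⟩
  · have := hL.continuous; fun_prop
  · rw [← hL.proj_eq]
    exact Strip.proj_eq_proj_iff.2 ⟨-n, rfl⟩
  · obtain ⟨ψ, hψ⟩ := P.dev_add_int (-n)
    simp only [hψ]
    exact ψ.isometry.comp hL.isometry
  · simp [hn]

namespace IsNormalForm

variable {P : HalfPants} {φ : ℍ ≃ᵢ ℍ} {q : ℝ}

/-- A development of a spiral ray is the development of a geodesic ray of the half-pants. -/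
lemma IsSpiralDevelopment.exists_lift {h : IsNormalForm (fun x => φ (P.dev x)) q} {γ : ℝ≥0 → ℍ}
    (hγ : h.IsSpiralDevelopment γ) : ∃ L : ℝ≥0 → Strip, (∀ t, φ (P.dev (L t)) = γ t) ∧
      L 0 = (0, 1) ∧ P.IsGeodesicLift (fun t => (L t).proj) L := by
  have hex : ∀ t, ∃ x : Strip, φ (P.dev x) = γ t := by
    intro t
    rcases eq_or_lt_of_le (zero_le (a := t)) with ht | ht
    · exact ⟨(0, 1), by rw [← ht, hγ.zero]⟩
    · obtain ⟨x, hx⟩ := h.isGraphRegionMap.graphRegion_subset_range (hγ.mem_region t ht)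
      exact ⟨x, axisCoordinates.injective hx⟩
  choose L hL using hex
  refine ⟨L, hL, h.injective ((hL 0).trans hγ.zero), ⟨?_, fun _ => rfl, ?_⟩⟩
  · rw [h.isGraphRegionMap.isClosedEmbedding.isInducing.continuous_iff]
    have : (fun x => axisCoordinates (φ (P.dev x))) ∘ L = fun t => axisCoordinates (γ t) :=
      funext fun t => by simp only [Function.comp_apply, hL]
    rw [this]
    exact axisCoordinates.continuous.comp hγ.isometry.continuous
  · have : (fun t => P.dev (L t)) = fun t => φ.symm (γ t) :=
      funext fun t => by rw [← hL, IsometryEquiv.symm_apply_apply]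
    rw [this]
    exact φ.symm.isometry.comp hγ.isometry

lemma tendsto_height (h : IsNormalForm (fun x => φ (P.dev x)) q) {γ : ℝ≥0 → ℍ}
    (hγ : h.IsSpiralDevelopment γ) : Tendsto (fun t => height (γ t)) atTop (𝓝 0) := by
  simp only [hγ.height_eq]
  have h1 : Tendsto (fun t : ℝ≥0 => Real.exp (-(t : ℝ))) atTop (𝓝 0) :=
    Real.tendsto_exp_neg_atTop_nhds_zero.comp (NNReal.tendsto_coe_atTop.2 tendsto_id)
  simpa using h1.const_mul (height (φ (P.dev (0, 1))))

/-- The height is invariant under the holonomy, so it is a function on the annulus; along the ray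
it tends to `0`, strictly decreasing. Hence the ray is simple and accumulates on the cuff only. It
accumulates at every point of the cuff because it visits the orbit of every modulus. -/
lemma IsSpiralDevelopment.isSpiralRay {h : IsNormalForm (fun x => φ (P.dev x)) q} {γ : ℝ≥0 → ℍ}
    (hγ : h.IsSpiralDevelopment γ) {L : ℝ≥0 → Strip} (hL : ∀ t, φ (P.dev (L t)) = γ t)
    (hL0 : L 0 = (0, 1)) (hlift : P.IsGeodesicLift (fun t => (L t).proj) L) :
    P.IsSpiralRay fun t => (L t).proj := by
  obtain ⟨F, hF⟩ : ∃ F : Annulus → ℝ, ∀ x : Strip, F x.proj = height (φ (P.dev x)) :=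
    ⟨fun y => Function.Periodic.lift (f := fun s => height (φ (P.dev (s, y.2)))) (c := 1)
      (fun s => h.height_add_one s y.2) y.1, fun x => rfl⟩
  have hFc : Continuous F := by
    rw [Strip.isOpenQuotientMap_proj.isQuotientMap.continuous_iff]
    exact (continuous_height.comp h.continuous).congr fun x => (hF x).symm
  refine ⟨⟨L, hlift⟩, by rw [hL0]; rfl, fun t t' he => ?_, ?_⟩
  · have h1 := congrArg F he
    simp only [hF, hL, hγ.height_eq] at h1
    have hpos := h.zipper_height_pos 0
    have h2 := mul_left_cancel₀ hpos.ne' h1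
    simpa using h2
  · ext x
    obtain ⟨y, rfl⟩ := Strip.isOpenQuotientMap_proj.surjective x
    change MapClusterPt _ _ _ ↔ y.2 = 0
    constructor
    · intro hx
      have h1 := hx.continuousAt_comp (f := F) hFc.continuousAt
      have h2 : Tendsto (F ∘ fun t => (L t).proj) atTop (𝓝 0) :=
        (h.tendsto_height hγ).congr fun t => by simp only [Function.comp_apply, hF, hL]
      have h3 : F y.proj = 0 := eq_of_nhds_neBot (ClusterPt.mono h1 h2)
      rw [hF] at h3
      exact h.isGraphRegionMap.height_eq_zero_iff.1 h3
    · intro hy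
      choose t ht k hk using fun n : ℕ =>
        hγ.exists_modSq_eq (modSq (φ (P.dev y))) (modSq_pos _) (n : ℝ≥0)
      have htt : Tendsto t atTop atTop :=
        tendsto_atTop_mono ht tendsto_natCast_atTop_atTop
      let x : ℕ → Strip := fun n => ((L (t n)).1 + (-k n : ℤ), (L (t n)).2)
      have hmod : ∀ n, modSq (φ (P.dev (x n))) = modSq (φ (P.dev y)) := fun n => by
        have hq : 0 < q ^ k n := zpow_pos h.pos _
        have := h.modSq_add_int (L (t n)).1 (L (t n)).2 (-k n)
        simp only [Prod.mk.eta, hL, hk] at this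
        rw [show modSq (φ (P.dev (x n))) = _ from this, zpow_neg]
        field_simp
      have hhei : ∀ n, height (φ (P.dev (x n))) = height (γ (t n)) := fun n => by
        have := h.height_add_int (L (t n)).1 (L (t n)).2 (-k n)
        simp only [Prod.mk.eta, hL] at this
        exact this
      have hx : Tendsto x atTop (𝓝 y) := by
        rw [h.isGraphRegionMap.isClosedEmbedding.isInducing.nhds_eq_comap, tendsto_comap_iff,
          Prod.tendsto_iff]
        constructor
        · simp only [Function.comp_apply, axisCoordinates_fst, hmod]
          exact tendsto_const_nhds
        · simp only [Function.comp_apply, axisCoordinates_snd, hhei]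
          rw [show height (φ (P.dev y)) = 0 from h.isGraphRegionMap.height_eq_zero_iff.2 hy]
          exact (h.tendsto_height hγ).comp htt
      refine MapClusterPt.of_comp htt (Tendsto.mapClusterPt ?_)
      have h1 := (Strip.isOpenQuotientMap_proj.continuous.tendsto y).comp hx
      refine h1.congr fun n => ?_
      exact Strip.proj_eq_proj_iff.2 ⟨-k n, rfl⟩

/-- Every complete geodesic ray from the cone point develops into one of the two rays asymptotic
to the ends of the axis, since the half-pants develops into a bounded neighbourhood of the axis. -/
lemma develop_eq (h : IsNormalForm (fun x => φ (P.dev x)) q) {r : ℝ≥0 → Annulus}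
    {L : ℝ≥0 → Strip} (hL : P.IsGeodesicLift r L) (hL0 : L 0 = (0, 1)) :
    (∀ t, φ (P.dev (L t)) = verticalRay (φ (P.dev (0, 1))) t) ∨
    ∀ t, φ (P.dev (L t)) = inversion (φ (P.dev (0, 1))) (verticalRay (φ (P.dev (0, 1))) t) := by
  obtain ⟨x, hx⟩ := exists_forall_le_of_periodic (G := fun x => |height (φ (P.dev x))|)
    (continuous_height.comp h.continuous).abs (fun s t => congrArg _ (h.height_add_one s t))
  have := eq_verticalRay_or_eq_inversion (φ.isometry.comp hL.isometry) fun t => hx (L t)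
  simp only [Function.comp_apply, hL0] at this
  exact this.imp congrFun congrFun

/-- The two rays asymptotic to the ends of the axis are all the spiral rays. -/
lemma exists_spiralRays (h : IsNormalForm (fun x => φ (P.dev x)) q) :
    ∃ L₁ L₂ : ℝ≥0 → Strip,
      (∀ t, φ (P.dev (L₁ t)) = verticalRay (φ (P.dev (0, 1))) t) ∧
      (∀ t, φ (P.dev (L₂ t)) =
        inversion (φ (P.dev (0, 1))) (verticalRay (φ (P.dev (0, 1))) t)) ∧
      L₁ 0 = (0, 1) ∧ L₂ 0 = (0, 1) ∧
      P.IsGeodesicLift (fun t => (L₁ t).proj) L₁ ∧ P.IsGeodesicLift (fun t => (L₂ t).proj) L₂ ∧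
      (fun t => (L₁ t).proj) ≠ (fun t => (L₂ t).proj) ∧
      ∀ r, P.IsSpiralRay r ↔ r = (fun t => (L₁ t).proj) ∨ r = fun t => (L₂ t).proj := by
  have s₁ := h.isSpiralDevelopment_verticalRay
  have s₂ := h.isSpiralDevelopment_inversion
  obtain ⟨L₁, hd₁, h0₁, hl₁⟩ := s₁.exists_lift
  obtain ⟨L₂, hd₂, h0₂, hl₂⟩ := s₂.exists_lift
  refine ⟨L₁, L₂, hd₁, hd₂, h0₁, h0₂, hl₁, hl₂, fun he => ?_, fun r => ⟨fun hr => ?_, ?_⟩⟩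
  · rw [← he] at hl₂
    have hLL := hl₁.unique hl₂ (h0₁.trans h0₂.symm)
    have h1 : modSq (verticalRay (φ (P.dev (0, 1))) 1) =
        modSq (inversion (φ (P.dev (0, 1))) (verticalRay (φ (P.dev (0, 1))) 1)) := by
      rw [← hd₂, ← hLL, hd₁]
    have h2 := modSq_lt_modSq_verticalRay (φ (P.dev (0, 1))) one_pos
    have h3 := modSq_pos (φ (P.dev (0, 1)))
    rw [modSq_inversion, eq_div_iff (modSq_pos _).ne'] at h1
    nlinarith
  · obtain ⟨L, hL, hL0⟩ := hr.isGeodesicRay.exists_lift hr.start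
    have hrL : r = fun t => (L t).proj := funext fun t => (hL.proj_eq t).symm
    rcases h.develop_eq hL hL0 with hd | hd
    · left
      rw [hrL]
      exact funext fun t => congrArg Strip.proj (h.injective ((hd t).trans (hd₁ t).symm))
    · right
      rw [hrL]
      exact funext fun t => congrArg Strip.proj (h.injective ((hd t).trans (hd₂ t).symm))
  · rintro (rfl | rfl)
    · exact s₁.isSpiralRay hd₁ h0₁ hl₁
    · exact s₂.isSpiralRay hd₂ h0₂ hl₂

end IsNormalForm

/-! ### Lengths and angles -/

/-- A boundary arc that develops into a hyperbolic line is as long as its ends are distant. -/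
lemma HalfPants.eVariationOn_eq_dist (P : HalfPants) {e : ℝ → ℍ} (he : Isometry e)
    (t : unitInterval) (hmem : ∀ s ∈ Icc (0 : ℝ) 1, P.dev (s, t) ∈ range e) :
    (eVariationOn (fun s : ℝ => P.dev (s, t)) (Icc 0 1)).toReal =
      dist (P.dev (0, t)) (P.dev (1, t)) := by
  have h0 : (0 : ℝ) ∈ Icc (0 : ℝ) 1 := by simp
  have h1 : (1 : ℝ) ∈ Icc (0 : ℝ) 1 := by simp
  obtain ⟨e, he, v, hv, hmono⟩ : ∃ e : ℝ → ℍ, Isometry e ∧ ∃ v : ℝ → ℝ,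
      (∀ s ∈ Icc (0 : ℝ) 1, e (v s) = P.dev (s, t)) ∧ MonotoneOn v (Icc 0 1) := by
    obtain ⟨v, hv, hvc, hvi⟩ := exists_line_coordinate P.continuous_dev P.locally_injective he
      ordConnected_Icc t hmem
    rcases hvc.strictMonoOn_of_injOn_Icc' zero_le_one hvi with h | h
    · exact ⟨e, he, v, hv, h.monotoneOn⟩
    · exact ⟨fun t => e (-t), he.comp (IsometryEquiv.neg ℝ).isometry, fun s => -v s,
        fun s hs => by simpa using hv s hs, h.antitoneOn.neg⟩
  have e1 : eVariationOn (fun s : ℝ => P.dev (s, t)) (Icc 0 1) = eVariationOn v (Icc 0 1) := by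
    rw [eVariationOn.congr (g := e ∘ v) fun s hs => (hv s hs).symm]
    simp only [eVariationOn, Function.comp_apply, he.edist_eq]
  have e2 := hmono.eVariationOn_eq h0 h1
  rw [inter_self] at e2
  have hle : 0 ≤ v 1 - v 0 := sub_nonneg.2 (hmono h0 h1 zero_le_one)
  rw [e1, e2, ENNReal.toReal_ofReal hle, ← hv 0 h0, ← hv 1 h1, he.dist_eq, dist_comm,
    Real.dist_eq, abs_of_nonneg hle]

/-- The angle at `p` between the upward vertical ray and the direction of a multiple of `p`. -/
lemma hyperbolicAngle_verticalRay {p w : ℍ} {c : ℝ} (hc : 0 < c) (hc1 : c ≠ 1)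
    (hre : w.re = c * p.re) (him : w.im = c * p.im) {t : ℝ≥0} (ht : 0 < t) :
    hyperbolicAngle p (verticalRay p t) w =
      Real.arccos ((c - 1) * ((c - 1) * p.re ^ 2 + (c + 1) * p.im ^ 2) /
        (2 * c * p.im ^ 2 * Real.sinh (dist w p))) := by
  have hb := p.im_pos
  have hv : verticalRay p t ≠ p := fun he => by
    have := modSq_lt_modSq_verticalRay p ht
    rw [he] at this
    exact lt_irrefl _ this
  have hw : w ≠ p := fun he => by
    rw [he] at him
    exact hc1 (mul_right_cancel₀ hb.ne' (by linarith))
  rw [hyperbolicAngle_eq_arccos hv hw]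
  congr 1
  have hd : dist (verticalRay p t) p = t := by
    have := (isometry_verticalRay p).dist_eq t 0
    rw [verticalRay_zero, NNReal.dist_eq] at this
    simpa using this
  have hS : 0 < Real.sinh (dist w p) := Real.sinh_pos_iff.2 (dist_pos.2 hw)
  have hE1 : 1 < Real.exp t := Real.one_lt_exp_iff.2 (by exact_mod_cast ht)
  rw [hd, UpperHalfPlane.cosh_dist', UpperHalfPlane.cosh_dist', hre, him, verticalRay_re,
    verticalRay_im, Real.cosh_eq, Real.sinh_eq, Real.exp_neg]
  generalize Real.sinh (dist w p) = S at *
  generalize Real.exp t = E at *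
  have hE : 0 < E := by linarith
  have hE2 : E ^ 2 - 1 ≠ 0 := by nlinarith
  have hE3 : E - E⁻¹ ≠ 0 := by
    rw [show E - E⁻¹ = (E ^ 2 - 1) / E by field_simp]
    exact div_ne_zero hE2 hE.ne'
  field_simp
  ring

/-- The trigonometry of the quadrilateral with a right angle at each end of half the cuff, cut
from the developed half-pants. Here `a + ib` is the cone point, `q` the multiplier of the holonomy,
`u` and `c` are the hyperbolic sine and cosine of half the zipper. The second arcsine is the angle of
parallelism, the first the angle of the zipper with the perpendicular to the cuff. -/
lemma spiral_trigonometry {a b q u c : ℝ} (ha : 0 < a) (hb : 0 < b) (hq : 1 < q) (hu : 0 < u)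
    (huc : u < c) (hu2 : 4 * q * b ^ 2 * u ^ 2 = (q - 1) ^ 2 * (a ^ 2 + b ^ 2))
    (hc2 : 4 * q * b ^ 2 * c ^ 2 = (q - 1) ^ 2 * a ^ 2 + (q + 1) ^ 2 * b ^ 2) :
    let θ := Real.arcsin ((q + 1) / (2 * √q) / c)
    let π' := Real.arcsin ((q - 1) / (2 * √q) / u)
    0 < π' ∧ π' < θ ∧ θ < Real.pi / 2 ∧
    Real.cos (θ - π') = (q - 1) * ((q - 1) * a ^ 2 + (q + 1) * b ^ 2) / (4 * q * b ^ 2 * u * c) ∧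
    Real.cos (θ + π') = (q - 1) * ((q - 1) * a ^ 2 - (q + 1) * b ^ 2) / (4 * q * b ^ 2 * u * c) := by
  intro θ π'
  have hc : 0 < c := hu.trans huc
  have hq0 : 0 < q := one_pos.trans hq
  have hq1 : 0 < q - 1 := sub_pos.2 hq
  have hk := Real.sqrt_pos.2 hq0
  have hk2 : √q ^ 2 = q := Real.sq_sqrt hq0.le
  have key : ∀ {x y : ℝ}, 0 < x → 0 < y → x ^ 2 + y ^ 2 = 1 →
      Real.sin (Real.arcsin x) = x ∧ Real.cos (Real.arcsin x) = y ∧ 0 < Real.arcsin x ∧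
      Real.arcsin x < Real.pi / 2 := by
    intro x y hx hy hxy
    have hx1 : x < 1 := by nlinarith
    refine ⟨Real.sin_arcsin (by linarith) hx1.le, ?_, Real.arcsin_pos.2 hx,
      Real.arcsin_lt_pi_div_two.2 hx1⟩
    rw [Real.cos_arcsin, show 1 - x ^ 2 = y ^ 2 by linarith, Real.sqrt_sq hy.le]
  obtain ⟨s1, c1, p1, l1⟩ := key (x := (q + 1) / (2 * √q) / c)
    (y := (q - 1) * a / (2 * √q * b * c)) (by positivity) (by positivity) (by
      field_simp
      rw [hk2]
      linarith)
  obtain ⟨s2, c2, p2, l2⟩ := key (x := (q - 1) / (2 * √q) / u)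
    (y := (q - 1) * a / (2 * √q * b * u)) (by positivity) (by positivity) (by
      field_simp
      rw [hk2]
      linarith)
  refine ⟨p2, ?_, l1, ?_, ?_⟩
  · by_contra! hle
    have h := Real.cos_le_cos_of_nonneg_of_le_pi p1.le (by linarith [Real.pi_pos]) hle
    rw [c1, c2] at h
    have : (q - 1) * a / (2 * √q * b * c) < (q - 1) * a / (2 * √q * b * u) :=
      div_lt_div_of_pos_left (by positivity) (by positivity)
        (mul_lt_mul_of_pos_left huc (by positivity))
    linarith
  · rw [Real.cos_sub, s1, s2, c1, c2]
    field_simp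
    rw [hk2]
    ring
  · rw [Real.cos_add, s1, s2, c1, c2]
    field_simp
    rw [hk2]
    ring

theorem mainTheorem6 (P : HalfPants) :
    0 < P.cuffLength ∧ P.cuffLength < P.zipperLength ∧
    ∃ r₁ r₂ : ℝ≥0 → Annulus,
      r₁ ≠ r₂ ∧
      (∀ r : ℝ≥0 → Annulus, P.IsSpiralRay r ↔ r = r₁ ∨ r = r₂) ∧
      ∃ σ β : ℝ, σ < β ∧ P.HasZipperAngles r₁ σ β ∧ P.HasZipperAngles r₂ β σ ∧
        σ = Real.arcsin (Real.cosh (P.cuffLength / 2) / Real.cosh (P.zipperLength / 2)) -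
          Real.arcsin (Real.sinh (P.cuffLength / 2) / Real.sinh (P.zipperLength / 2)) := by
  obtain ⟨φ, q, h⟩ := P.exists_normalForm
  have hq := h.one_lt
  have hq0 := h.pos
  set p := φ (P.dev (0, 1)) with hp
  set w := φ (P.dev (1, 1)) with hw
  set w' := φ (P.dev (-1, 1)) with hw'
  have ha : 0 < p.re := h.conePoint_re_pos
  have hb := p.im_pos
  have hwre : w.re = q * p.re := by simpa using h.re_add_one 0 1
  have hwim : w.im = q * p.im := by simpa using h.im_add_one 0 1
  have hwre' : w'.re = q⁻¹ * p.re := by simpa using (h.re_im_add_int 0 1 (-1)).1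
  have hwim' : w'.im = q⁻¹ * p.im := by simpa using (h.re_im_add_int 0 1 (-1)).2
  have hwp : w ≠ p := fun he => by rw [he] at hwim; nlinarith
  have hwp' : w' ≠ p := fun he => by
    rw [he] at hwim'
    have := inv_lt_one_of_one_lt₀ hq
    nlinarith
  -- The lengths of the cuff and of the zipper.
  have hcuff : P.cuffLength = Real.log q := by
    obtain ⟨e, he, hmem⟩ := P.cuff_geodesic
    rw [HalfPants.cuffLength, P.eVariationOn_eq_dist he 0 fun s _ => hmem s, ← φ.dist_eq]
    have him := h.im_add_one 0 0
    rw [zero_add] at him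
    rw [UpperHalfPlane.dist_of_re_eq (by rw [h.cuff_re, h.cuff_re]), him, Real.dist_eq,
      Real.log_mul hq0.ne' (φ (P.dev (0, 0))).im_ne_zero, abs_sub_comm, add_sub_cancel_right,
      abs_of_pos (Real.log_pos hq)]
  have hzip : P.zipperLength = dist w p := by
    obtain ⟨e, he, hmem⟩ := P.zipper_geodesic
    rw [HalfPants.zipperLength, P.eVariationOn_eq_dist he 1 hmem, ← φ.dist_eq, dist_comm]
  have hzip' : dist w' p = dist w p := dist_eq_of_cosh_eq (by
    rw [UpperHalfPlane.cosh_dist', UpperHalfPlane.cosh_dist', hwre, hwim, hwre', hwim']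
    field_simp
    ring)
  have hexp : Real.exp (Real.log q / 2) = √q := by rw [Real.exp_half, Real.exp_log hq0]
  have hk := Real.sqrt_pos.2 hq0
  have hk2 : √q ^ 2 = q := Real.sq_sqrt hq0.le
  have hcosh : Real.cosh (Real.log q / 2) = (q + 1) / (2 * √q) := by
    rw [Real.cosh_eq, Real.exp_neg, hexp]
    field_simp
    rw [hk2]
  have hsinh : Real.sinh (Real.log q / 2) = (q - 1) / (2 * √q) := by
    rw [Real.sinh_eq, Real.exp_neg, hexp]
    field_simp
    rw [hk2]
  have hZ := UpperHalfPlane.cosh_dist' w p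
  rw [hwre, hwim, show dist w p = 2 * (dist w p / 2) by ring, Real.cosh_two_mul] at hZ
  have hcs := Real.cosh_sq (dist w p / 2)
  have hS : Real.sinh (dist w p) = 2 * Real.sinh (dist w p / 2) * Real.cosh (dist w p / 2) := by
    rw [← Real.sinh_two_mul]; congr 1; ring
  have hu : 0 < Real.sinh (dist w p / 2) := Real.sinh_pos_iff.2 (half_pos (dist_pos.2 hwp))
  have huc : Real.sinh (dist w p / 2) < Real.cosh (dist w p / 2) := Real.sinh_lt_cosh _
  rw [hcuff, hzip, hcosh, hsinh]
  have hzlt : (q - 1) / (2 * √q) < Real.sinh (dist w p / 2) → Real.log q < dist w p := by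
    intro hlt
    rw [← hsinh] at hlt
    linarith [Real.sinh_lt_sinh.1 hlt]
  generalize Real.sinh (dist w p / 2) = u at *
  generalize Real.cosh (dist w p / 2) = c at *
  field_simp at hZ
  have hu2 : 4 * q * p.im ^ 2 * u ^ 2 = (q - 1) ^ 2 * (p.re ^ 2 + p.im ^ 2) := by
    linear_combination hZ - 2 * q * p.im ^ 2 * hcs
  have hc2 : 4 * q * p.im ^ 2 * c ^ 2 =
      (q - 1) ^ 2 * p.re ^ 2 + (q + 1) ^ 2 * p.im ^ 2 := by
    linear_combination hZ + 2 * q * p.im ^ 2 * hcs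
  obtain ⟨hπ, hθ, hθ', hcos, hcos'⟩ := spiral_trigonometry ha hb hq hu huc hu2 hc2
  set θ := Real.arcsin ((q + 1) / (2 * √q) / c)
  set π' := Real.arcsin ((q - 1) / (2 * √q) / u) with hπ'
  have hc : 0 < c := hu.trans huc
  -- The angles of the vertical ray with the two ends of the zipper.
  have hang : ∀ {t : ℝ≥0}, 0 < t → hyperbolicAngle p (verticalRay p t) w = θ - π' := fun ht => by
    rw [hyperbolicAngle_verticalRay hq0 hq.ne' hwre hwim ht, hS, ← Real.arccos_cos
      (x := θ - π') (by linarith) (by linarith [Real.pi_pos]), hcos]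
    congr 1
    field_simp
    norm_num
  have hang' : ∀ {t : ℝ≥0}, 0 < t → hyperbolicAngle p (verticalRay p t) w' = θ + π' := fun ht => by
    rw [hyperbolicAngle_verticalRay (inv_pos.2 hq0) (inv_ne_one.2 hq.ne') hwre' hwim' ht, hzip',
      hS, ← Real.arccos_cos (x := θ + π') (by linarith) (by linarith), hcos']
    congr 1
    field_simp
    ring
  obtain ⟨L₁, L₂, hd₁, hd₂, h0₁, h0₂, hl₁, hl₂, hne, huniq⟩ := h.exists_spiralRays
  have hv : ∀ {t : ℝ≥0}, 0 < t → verticalRay p t ≠ p := fun {t} ht he => by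
    have := modSq_lt_modSq_verticalRay p ht
    rw [he] at this
    exact lt_irrefl _ this
  -- The reflection in the perpendicular to the cuff exchanges the rays and the ends of the zipper.
  have hJ : ∀ {c : ℝ} {z z' : ℍ}, 0 < c → z.re = c * p.re → z.im = c * p.im →
      z'.re = c⁻¹ * p.re → z'.im = c⁻¹ * p.im → inversion p z = z' := by
    intro c z z' hc h1 h2 h3 h4
    have hm : modSq z = c ^ 2 * modSq p := by simp only [modSq, h1, h2]; ring
    have := (modSq_pos p).ne'
    apply UpperHalfPlane.ext_re_im
    · rw [inversion_re, hm, h1, h3]; field_simp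
    · rw [inversion_im, hm, h2, h4]; field_simp
  have hJw : inversion p w = w' := hJ hq0 hwre hwim hwre' hwim'
  have hJw' : inversion p w' = w := by rw [← hJw, inversion_inversion]
  have hflip : ∀ {t : ℝ≥0} {z : ℍ}, 0 < t → z ≠ p →
      hyperbolicAngle p (inversion p (verticalRay p t)) (inversion p z) =
        hyperbolicAngle p (verticalRay p t) z := fun {t z} ht hz => by
    have := hyperbolicAngle_map (isometry_inversion p) (hv ht) hz
    rwa [inversion_self] at this
  have hdev : ∀ {x y z : Strip}, φ (P.dev y) ≠ φ (P.dev x) → φ (P.dev z) ≠ φ (P.dev x) →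
      hyperbolicAngle (P.dev x) (P.dev y) (P.dev z) =
        hyperbolicAngle (φ (P.dev x)) (φ (P.dev y)) (φ (P.dev z)) := fun h1 h2 =>
    (hyperbolicAngle_map φ.isometry (fun he => h1 (congrArg φ he))
      (fun he => h2 (congrArg φ he))).symm
  refine ⟨Real.log_pos hq, hzlt ?_, _, _, hne, huniq, θ - π', θ + π', by linarith,
    ⟨L₁, hl₁, h0₁, fun t ht => ?_⟩, ⟨L₂, hl₂, h0₂, fun t ht => ?_⟩, rfl⟩
  · have : π' < Real.pi / 2 := hθ.trans hθ'
    rw [hπ', Real.arcsin_lt_pi_div_two, div_lt_one hu] at this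
    exact this
  · have h1 : φ (P.dev (L₁ t)) ≠ p := by rw [hd₁]; exact hv ht
    rw [hdev h1 hwp, hdev h1 hwp', hd₁]
    exact ⟨hang ht, hang' ht⟩
  · have h1 : φ (P.dev (L₂ t)) ≠ p := by
      rw [hd₂]
      intro he
      apply hv ht
      rw [← inversion_inversion p (verticalRay p t), he, inversion_self]
    rw [hdev h1 hwp, hdev h1 hwp', hd₂]
    constructor
    · rw [← hang' ht, ← hflip ht hwp', hJw']
    · rw [← hang ht, ← hflip ht hwp, hJw]
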